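/- **Theorem 3.2 (Fueter–Funk–Hecke theorem).** Let $p\ge 3$, $q\ge 1$, $m=p+q$, and let $\mathbb R_{0,m}$ be the real Clifford algebra generated by $e_1,\dots,e_m$ with $e_ie_j+e_je_i=-2\delta_{ij}$. For $(\underline x,\underline y)\in\mathbb R^p\oplus\mathbb R^q=\mathbb R^m$ identify $\underline x=\sum_{j=1}^p x_je_j$ and $\underline y=\sum_{j=1}^q x_{p+j}e_{p+j}$, and put $r=|\underline x|$, $\rho=|\underline y|$, $\underline\omega=\underline x/r$, $\underline\nu=\underline y/\rho$. A function is called monogenic if it is annihilated from the left by the Dirac operator: $\partial_{\underline x}=\sum_{j=1}^p e_j\partial_{x_j}$ on $\mathbb R^p$, $\partial_{\underline y}=\sum_{j=1}^q e_{p+j}\partial_{x_{p+j}}$ on $\mathbb R^q$, and $\partial_{\underline x}+\partial_{\underline y}$ on $\mathbb R^m$. Let $P_k(\underline x)$ and $P_\ell(\underline y)$ be homogeneous monogenic polynomials on $\mathbb R^p$ and $\mathbb R^q$, of degrees $k,\ell\ge0$, with values in the even subalgebras of the Clifford algebras generated by $e_1,\dots,e_p$ and by $e_{p+1},\dots,e_{p+q}$,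 respectively. Let $h=u+iv$ be holomorphic in an open subset $\Xi$ of the upper half-plane $\{(r,\rho)\in\mathbb R^2:\rho>0\}$ (with $z=r+i\rho$) such that $(rt,\rho)\in\Xi$ whenever $(r,\rho)\in\Xi$ and $t\in[-1,1]$. Let $C_n=C_n^{\lambda}$, $\lambda=(p-2)/2$, be the Gegenbauer polynomials, given by $C_0=1$, $C_1(t)=2\lambda t$ and $nC_n(t)=2(n+\lambda-1)\,t\,C_{n-1}(t)-(n+2\lambda-2)\,C_{n-2}(t)$ for $n\ge2$, and define $$A(r,\rho)=C_k(1)^{-1}r^{-k}\int_{-1}^1u(rt,\rho)\,C_k(t)\,(1-t^2)^{(p-3)/2}\,dt,$$ $$B(r,\rho)=C_{k+1}(1)^{-1}r^{-k}\int_{-1}^1v(rt,\rho)\,C_{k+1}(t)\,(1-t^2)^{(p-3)/2}\,dt.$$ If $q$ is odd, then the function $$F(\underline x,\underline y)=\big(A(r,\rho)-\underline\omega\,\underline\nu\,B(r,\rho)\big)P_k(\underline x)P_\ell(\underline y)$$ is infinitely differentiable in $\Omega=\{(\underline x,\underline y)\in\mathbb R^m:(r,\rho)\in\Xi\}$, where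 at the points with $\underline x=0$ it is understood through its continuous extension (whose value there is $A(0,\rho)P_0P_\ell(\underline y)$ if $k=0$, with $r^{-0}=1$ in $A$, and $0$ if $k\ge1$), and $$(\Delta_{\underline x}+\Delta_{\underline y})^{\ell+\frac{q-1}{2}}F$$ is monogenic in $\Omega$. -/

import Mathlib

open scoped ContDiff

noncomputable section

namespace CliffordAnalysis

/-! ### The real Clifford algebra -/

/-- The quadratic form `x ↦ -(x₁² + ⋯ + xₘ²)`. -/
def negSq (σ : Type) [Fintype σ] : QuadraticForm ℝ (σ → ℝ) :=
  QuadraticMap.weightedSumSquares ℝ (fun _ : σ => (-1 : ℝ))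

/-- The real Clifford algebra `ℝ_{0,m}` whose generators are indexed by `σ` (with `m = |σ|`),
subject to `e_j e_k + e_k e_j = -2 δ_{jk}`. -/
abbrev Cl (σ : Type) [Fintype σ] : Type := CliffordAlgebra (negSq σ)

/-- The Clifford algebra is linearly isomorphic to the exterior algebra, so it has finite
dimension. -/
instance instFiniteCl (σ : Type) [Fintype σ] : Module.Finite ℝ (Cl σ) := by
  classical
  let : LinearOrder σ := linearOrderOfSTO WellOrderingRel
  let : Invertible (2 : ℝ) := invertibleOfNonzero two_ne_zero
  have : Module.Finite ℝ (ExteriorAlgebra ℝ (σ → ℝ)) :=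
    Module.Finite.of_basis (Pi.basisFun ℝ σ).ExteriorAlgebra
  exact Module.Finite.equiv (CliffordAlgebra.equivExterior (negSq σ)).symm

/-- Coordinates of a Clifford number with respect to a basis. -/
def coords (σ : Type) [Fintype σ] :
    Cl σ ≃ₗ[ℝ] (Fin (Module.finrank ℝ (Cl σ)) → ℝ) :=
  (Module.finBasis ℝ (Cl σ)).equivFun

/-- A norm on the finite-dimensional real vector space `ℝ_{0,m}` (all of them are equivalent); it
serves only to speak of derivatives of Clifford-valued functions. -/
instance instNormedAddCommGroupCl (σ : Type) [Fintype σ] : NormedAddCommGroup (Cl σ) :=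
  NormedAddCommGroup.induced (Cl σ) (Fin (Module.finrank ℝ (Cl σ)) → ℝ) (coords σ)
    (coords σ).injective

instance instNormedSpaceCl (σ : Type) [Fintype σ] : NormedSpace ℝ (Cl σ) :=
  NormedSpace.induced ℝ (Cl σ) (Fin (Module.finrank ℝ (Cl σ)) → ℝ) (coords σ)

/-- The generator `e_j`. -/
def gen {σ : Type} [Fintype σ] [DecidableEq σ] (j : σ) : Cl σ :=
  CliffordAlgebra.ι (negSq σ) (Pi.single j 1)

/-- The inclusion `ℝ^σ → ℝ^τ` that sends the basis vector with index `j` to the one with index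
`f j` preserves the quadratic forms. -/
def inclIsometry {σ τ : Type} [Fintype σ] [Fintype τ] (f : σ ↪ τ) : negSq σ →qᵢ negSq τ where
  toLinearMap := Function.ExtendByZero.linearMap ℝ f
  map_app' := by
    intro x
    classical
    simp only [negSq, QuadraticMap.weightedSumSquares_apply]
    symm
    refine Finset.sum_of_injOn f f.injective.injOn (by simp) ?_ ?_
    · intro i _ hi
      have : Function.extend f x 0 i = 0 := by
        rw [Function.extend_apply']
        · rfl
        · rintro ⟨a, rfl⟩
          exact hi ⟨a, by simp, rfl⟩
      simp [this]
    · intro i _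
      simp [f.injective.extend_apply]

/-- The inclusion of Clifford algebras with `e_j ↦ e_{f j}`. -/
def incl {σ τ : Type} [Fintype σ] [Fintype τ] (f : σ ↪ τ) : Cl σ →ₐ[ℝ] Cl τ :=
  CliffordAlgebra.map (inclIsometry f)

/-! ### Monogenic functions -/

/-- The Dirac operator `∑ⱼ e_j ∂_{x_j}`, acting from the left. -/
def dirac {σ : Type} [Fintype σ] [DecidableEq σ] (f : EuclideanSpace ℝ σ → Cl σ)
    (X : EuclideanSpace ℝ σ) : Cl σ :=
  ∑ j : σ, gen j * fderiv ℝ f X (EuclideanSpace.single j 1)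

/-- (Left) monogenic functions in an open set: `C¹` null solutions of the Dirac operator. -/
def IsMonogenicOn {σ : Type} [Fintype σ] [DecidableEq σ] (f : EuclideanSpace ℝ σ → Cl σ)
    (U : Set (EuclideanSpace ℝ σ)) : Prop :=
  ContDiffOn ℝ 1 f U ∧ ∀ X ∈ U, dirac f X = 0

/-- Homogeneous polynomials of degree `k` with Clifford coefficients:
`P(x) = ∑_{|α| = k} x^α c_α`. -/
def IsHomogeneousPolynomial {σ : Type} [Fintype σ] [DecidableEq σ] (k : ℕ)
    (P : EuclideanSpace ℝ σ → Cl σ) : Prop :=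
  ∃ c : (σ → ℕ) → Cl σ, ∀ x : EuclideanSpace ℝ σ,
    P x = ∑ α ∈ Finset.piAntidiag Finset.univ k, (∏ j : σ, x j ^ α j) • c α

/-! ### The biaxial splitting `ℝ^{p+q} = ℝ^p ⊕ ℝ^q` -/

/-- The component `x ∈ ℝ^p` of `X ∈ ℝ^p ⊕ ℝ^q`. -/
def xPart {p q : ℕ} (X : EuclideanSpace ℝ (Fin p ⊕ Fin q)) : EuclideanSpace ℝ (Fin p) :=
  WithLp.toLp 2 fun j => X (Sum.inl j)

/-- The component `y ∈ ℝ^q` of `X ∈ ℝ^p ⊕ ℝ^q`. -/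
def yPart {p q : ℕ} (X : EuclideanSpace ℝ (Fin p ⊕ Fin q)) : EuclideanSpace ℝ (Fin q) :=
  WithLp.toLp 2 fun j => X (Sum.inr j)

/-- `ω = x / |x|` as a Clifford vector, where `x = ∑_{j ≤ p} x_j e_j` (and `0` if `x = 0`). -/
def omega {p q : ℕ} (X : EuclideanSpace ℝ (Fin p ⊕ Fin q)) : Cl (Fin p ⊕ Fin q) :=
  ‖xPart X‖⁻¹ • ∑ j : Fin p, X (Sum.inl j) • gen (Sum.inl j)

/-- `ν = y / |y|` as a Clifford vector, where `y = ∑_{j ≤ q} x_{p+j} e_{p+j}`. -/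
def nu {p q : ℕ} (X : EuclideanSpace ℝ (Fin p ⊕ Fin q)) : Cl (Fin p ⊕ Fin q) :=
  ‖yPart X‖⁻¹ • ∑ j : Fin q, X (Sum.inr j) • gen (Sum.inr j)

/-- `Ω = {(x, y) : (r, ρ) ∈ Ξ}` with `r = |x|`, `ρ = |y|`; the point `(r, ρ)` of the plane is
identified with `r + iρ`. -/
def biaxialRegion (p q : ℕ) (Ξ : Set ℂ) : Set (EuclideanSpace ℝ (Fin p ⊕ Fin q)) :=
  {X | (⟨‖xPart X‖, ‖yPart X‖⟩ : ℂ) ∈ Ξ}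

/-! ### Gegenbauer polynomials and the Fueter-Funk-Hecke transform -/

/-- The Gegenbauer polynomial `C_k^μ`, by its three-term recurrence. -/
def gegenbauer (μ : ℝ) : ℕ → Polynomial ℝ
  | 0 => 1
  | 1 => Polynomial.C (2 * μ) * Polynomial.X
  | n + 2 =>
    Polynomial.C (1 / ((n : ℝ) + 2)) *
      (Polynomial.C (2 * ((n : ℝ) + 2 + μ - 1)) * Polynomial.X * gegenbauer μ (n + 1) -
        Polynomial.C ((n : ℝ) + 2 + 2 * μ - 2) * gegenbauer μ n)

/-- `C_k = C_k^{(p-2)/2}`. -/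
def gegenbauerC (p k : ℕ) : Polynomial ℝ := gegenbauer (((p : ℝ) - 2) / 2) k

/-- `∫_{-1}^{1} w(rt, ρ) C_n(t) (1 - t²)^{(p-3)/2} dt / C_n(1)`. -/
def funkHeckeMean (p n : ℕ) (w : ℂ → ℝ) (r ρ : ℝ) : ℝ :=
  ((gegenbauerC p n).eval 1)⁻¹ *
    ∫ t in (-1 : ℝ)..1,
      w ⟨r * t, ρ⟩ * (gegenbauerC p n).eval t * (1 - t ^ 2) ^ (((p : ℝ) - 3) / 2)

/-- `A(r, ρ) = C_k(1)⁻¹ r^{-k} ∫_{-1}^{1} u(rt, ρ) C_k(t) (1 - t²)^{(p-3)/2} dt`, `u = Re h`. -/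
def coeffA (p k : ℕ) (h : ℂ → ℂ) (r ρ : ℝ) : ℝ :=
  r ^ (-(k : ℤ)) * funkHeckeMean p k (fun z => (h z).re) r ρ

/-- `B(r, ρ) = C_{k+1}(1)⁻¹ r^{-k} ∫_{-1}^{1} v(rt, ρ) C_{k+1}(t) (1 - t²)^{(p-3)/2} dt`,
`v = Im h`. -/
def coeffB (p k : ℕ) (h : ℂ → ℂ) (r ρ : ℝ) : ℝ :=
  r ^ (-(k : ℤ)) * funkHeckeMean p (k + 1) (fun z => (h z).im) r ρ

/-- `(A(r, ρ) - ω ν B(r, ρ)) P_k(x) P_ℓ(y)`, with `P_k(x) ∈ ℝ_{0,p}` and `P_ℓ(y) ∈ ℝ_{0,q}`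
regarded as elements of `ℝ_{0,p+q}`.

Where `x = 0` the formula is meant through its continuous extension. The conventions `0⁻¹ = 0` and
`0 ^ 0 = 1` yield just that: the value at `x = 0` is `A(0, ρ) P_0 P_ℓ(y)` if `k = 0`, and `0` if
`k ≥ 1`. -/
def biaxialSeed {p q : ℕ} (k : ℕ) (h : ℂ → ℂ) (Pk : EuclideanSpace ℝ (Fin p) → Cl (Fin p))
    (Pl : EuclideanSpace ℝ (Fin q) → Cl (Fin q)) (X : EuclideanSpace ℝ (Fin p ⊕ Fin q)) :
    Cl (Fin p ⊕ Fin q) :=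
  (algebraMap ℝ (Cl (Fin p ⊕ Fin q)) (coeffA p k h ‖xPart X‖ ‖yPart X‖) -
      coeffB p k h ‖xPart X‖ ‖yPart X‖ • (omega X * nu X)) *
    incl Function.Embedding.inl (Pk (xPart X)) * incl Function.Embedding.inr (Pl (yPart X))

/-- The Fueter-Funk-Hecke transform
`Ft_{p,q}[h, P_k, P_ℓ] = (Δ_x + Δ_y)^{ℓ + (q-1)/2} ((A - ω ν B) P_k P_ℓ)`; here `Δ_x + Δ_y` is the
Laplacian of `ℝ^{p+q} = ℝ^p ⊕ ℝ^q`. -/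
def fueterFunkHecke {p q : ℕ} (k l : ℕ) (h : ℂ → ℂ)
    (Pk : EuclideanSpace ℝ (Fin p) → Cl (Fin p)) (Pl : EuclideanSpace ℝ (Fin q) → Cl (Fin q)) :
    EuclideanSpace ℝ (Fin p ⊕ Fin q) → Cl (Fin p ⊕ Fin q) :=
  (fun f : EuclideanSpace ℝ (Fin p ⊕ Fin q) → Cl (Fin p ⊕ Fin q) =>
    Laplacian.laplacian f)^[l + (q - 1) / 2] (biaxialSeed k h Pk Pl)

end CliffordAnalysis

end

/-! Write x, y for the two Clifford vectors, G = P_k(x) P_ℓ(y) and μ = k + (p-3)/2. Repeated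
integration by parts (`integral_mul_gegenbauer`) turns A into the mean over t of Re H(rt, ρ) with
weight (1-t²)^μ, where H is a constant multiple of the k-th derivative of h. It turns B into rρ·b,
where b is, up to a constant, the mean of ρ⁻¹∂_r Im H with weight (1-t²)^(μ+1). All negative powers
of r disappear, so F = (a - b x y) G with a, b smooth also across x = 0 (`biaxialSeed_eq`,
`contDiffOn_meanField`).

Put a_n = (ρ⁻¹∂_ρ)ⁿ a and b_n = (ρ⁻¹∂_ρ)ⁿ b. The Cauchy–Riemann equations and the recursion of the
means in μ yield a first-order system for these functions (`IsConjugatePair.isVekuaSequence`). Since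
G is monogenic and bihomogeneous, the Dirac operator sends (a_n - b_n x y) G to (2n+1-q-2ℓ) b_n x G,
and b_n x G to (a_{n+1} - b_{n+1} x y) G. The Laplacian is minus the square of the Dirac operator,
so it raises n by one up to a constant factor. At n = ℓ + (q-1)/2 the factor 2n+1-q-2ℓ vanishes,
which is monogenicity; this n is an integer because q is odd.

The evenness of P_k enters only in the monogenicity of G, where the generators of ℝ^q have to pass
P_k(x). -/

noncomputable section

namespace CliffordAnalysis

/-! ### Gegenbauer polynomials and the Rodrigues formula -/

/-- Integration by parts against the Gegenbauer weight. -/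
theorem integral_mul_id_mul_weight {μ : ℝ} (hμ : 0 ≤ μ) {f f' : ℝ → ℝ}
    (hf : ∀ t ∈ Set.Icc (-1 : ℝ) 1, HasDerivAt f (f' t) t)
    (hf' : ContinuousOn f' (Set.Icc (-1) 1)) :
    ∫ t in (-1 : ℝ)..1, f t * t * (1 - t ^ 2) ^ μ =
      (2 * (μ + 1))⁻¹ * ∫ t in (-1 : ℝ)..1, f' t * (1 - t ^ 2) ^ (μ + 1) := by
  have hμ1 : μ + 1 ≠ 0 := by positivity
  have hI : Set.uIcc (-1 : ℝ) 1 = Set.Icc (-1) 1 := Set.uIcc_of_le (by norm_num)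
  -- This primitive of t(1-t²)^μ vanishes at both endpoints because μ + 1 ≠ 0, so no boundary terms
  -- remain.
  have hv : ∀ t ∈ Set.uIcc (-1 : ℝ) 1,
      HasDerivAt (fun t : ℝ => -(2 * (μ + 1))⁻¹ * (1 - t ^ 2) ^ (μ + 1)) (t * (1 - t ^ 2) ^ μ) t := by
    intro t _
    have h1 : HasDerivAt (fun t : ℝ => 1 - t ^ 2) (-(2 * t)) t := by
      simpa using (hasDerivAt_pow 2 t).const_sub 1
    have h2 := (h1.rpow_const (p := μ + 1) (Or.inr (by linarith))).const_mul (-(2 * (μ + 1))⁻¹)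
    refine h2.congr_deriv ?_
    rw [add_sub_cancel_right]
    field_simp
  have h := intervalIntegral.integral_mul_deriv_eq_deriv_mul (a := (-1 : ℝ)) (b := 1)
    (u := f) (u' := f') (fun t ht => hf t (hI ▸ ht)) hv
    (ContinuousOn.intervalIntegrable (hI ▸ hf'))
    (Continuous.intervalIntegrable (by fun_prop (disch := exact hμ)) _ _)
  simp only [mul_assoc]
  rw [h, ← intervalIntegral.integral_const_mul]
  simp only [one_pow, sub_self, Real.zero_rpow hμ1, neg_sq, mul_zero, zero_sub]
  rw [← intervalIntegral.integral_neg]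
  congr 1
  ext t
  ring

/-- Apply the preceding identity to t·f(t) and replace t² by 1 - (1-t²), which raises the exponent
by one. -/
theorem integral_deriv_mul_id_mul_weight {μ : ℝ} (hμ : 0 ≤ μ) {f f' : ℝ → ℝ}
    (hf : ∀ t ∈ Set.Icc (-1 : ℝ) 1, HasDerivAt f (f' t) t)
    (hf' : ContinuousOn f' (Set.Icc (-1) 1)) :
    ∫ t in (-1 : ℝ)..1, f' t * t * (1 - t ^ 2) ^ (μ + 1) =
      2 * (μ + 1) * (∫ t in (-1 : ℝ)..1, f t * (1 - t ^ 2) ^ μ) -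
        (2 * μ + 3) * ∫ t in (-1 : ℝ)..1, f t * (1 - t ^ 2) ^ (μ + 1) := by
  have hI : Set.uIcc (-1 : ℝ) 1 = Set.Icc (-1) 1 := Set.uIcc_of_le (by norm_num)
  have hc : ContinuousOn f (Set.Icc (-1) 1) := fun t ht => (hf t ht).continuousAt.continuousWithinAt
  have hw : ∀ ν : ℝ, 0 ≤ ν → Continuous fun t : ℝ => (1 - t ^ 2) ^ ν := fun ν hν => by
    fun_prop (disch := exact hν)
  have hμ1 : (0 : ℝ) ≤ μ + 1 := by positivity
  have hint : ∀ {g : ℝ → ℝ} {ν : ℝ}, 0 ≤ ν → ContinuousOn g (Set.Icc (-1) 1) →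
      IntervalIntegrable (fun t => g t * (1 - t ^ 2) ^ ν) MeasureTheory.volume (-1) 1 := by
    intro g ν hν hg
    exact ContinuousOn.intervalIntegrable (hI ▸ hg.mul (hw ν hν).continuousOn)
  have key := integral_mul_id_mul_weight hμ (f := fun t => f t * t) (f' := fun t => f' t * t + f t)
    (fun t ht => ((hf t ht).mul (hasDerivAt_id' t)).congr_deriv (by ring))
    ((hf'.mul continuousOn_id).add hc)
  have e1 : ∫ t in (-1 : ℝ)..1, f t * t * t * (1 - t ^ 2) ^ μ =
      (∫ t in (-1 : ℝ)..1, f t * (1 - t ^ 2) ^ μ) -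
        ∫ t in (-1 : ℝ)..1, f t * (1 - t ^ 2) ^ (μ + 1) := by
    rw [← intervalIntegral.integral_sub (hint hμ hc) (hint hμ1 hc)]
    refine intervalIntegral.integral_congr fun t ht => ?_
    have h0 : 0 ≤ 1 - t ^ 2 := by
      rw [hI] at ht
      nlinarith [ht.1, ht.2]
    rw [Real.rpow_add_one' h0 (by positivity)]
    ring
  have e2 : ∫ t in (-1 : ℝ)..1, (f' t * t + f t) * (1 - t ^ 2) ^ (μ + 1) =
      (∫ t in (-1 : ℝ)..1, f' t * t * (1 - t ^ 2) ^ (μ + 1)) +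
        ∫ t in (-1 : ℝ)..1, f t * (1 - t ^ 2) ^ (μ + 1) := by
    rw [← intervalIntegral.integral_add (hint (g := fun t => f' t * t) hμ1 (hf'.mul continuousOn_id))
      (hint hμ1 hc)]
    simp only [add_mul]
  rw [e1, e2] at key
  have : 2 * (μ + 1) ≠ 0 := by positivity
  field_simp at key
  linarith

theorem gegenbauer_eval_add_two (μ : ℝ) (n : ℕ) (t : ℝ) :
    ((n : ℝ) + 2) * (gegenbauer μ (n + 2)).eval t =
      2 * (n + 1 + μ) * t * (gegenbauer μ (n + 1)).eval t -
        (n + 2 * μ) * (gegenbauer μ n).eval t := by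
  have : (n : ℝ) + 2 ≠ 0 := by positivity
  simp only [gegenbauer, Polynomial.eval_mul, Polynomial.eval_sub, Polynomial.eval_C,
    Polynomial.eval_X]
  field_simp
  ring

/-- At t = 1 the three-term recurrence collapses to a two-term one. It gives the positivity of
C_n(1) and the cancellation in the Rodrigues formula. -/
theorem gegenbauer_eval_one_succ (μ : ℝ) (n : ℕ) :
    ((n : ℝ) + 1) * (gegenbauer μ (n + 1)).eval 1 = (n + 2 * μ) * (gegenbauer μ n).eval 1 := by
  induction n with
  | zero => simp [gegenbauer]
  | succ n ih =>
    have := gegenbauer_eval_add_two μ n 1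
    push_cast
    linear_combination this + ih

theorem gegenbauer_eval_one_pos {μ : ℝ} (hμ : 0 < μ) (n : ℕ) :
    0 < (gegenbauer μ n).eval 1 := by
  induction n with
  | zero => simp [gegenbauer]
  | succ n ih =>
    have h : 0 < ((n : ℝ) + 1) * (gegenbauer μ (n + 1)).eval 1 := by
      rw [gegenbauer_eval_one_succ]
      positivity
    exact pos_of_mul_pos_right h (by positivity)

/-- The constant of the Rodrigues formula for the normalised Gegenbauer polynomials. -/
def rodriguesConst (μ : ℝ) (n : ℕ) : ℝ := ∏ j ∈ Finset.range n, (2 * (j : ℝ) + 2 * μ + 1)⁻¹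

theorem rodriguesConst_succ (μ : ℝ) (n : ℕ) :
    rodriguesConst μ (n + 1) = rodriguesConst μ n * (2 * (n : ℝ) + 2 * μ + 1)⁻¹ :=
  Finset.prod_range_succ _ _

/-- A sequence of functions, each the derivative of the preceding one on `[-1, 1]`. -/
def IsDerivChain (f : ℕ → ℝ → ℝ) : Prop :=
  ∀ n, ∀ t ∈ Set.Icc (-1 : ℝ) 1, HasDerivAt (f n) (f (n + 1) t) t

theorem IsDerivChain.continuousOn {f : ℕ → ℝ → ℝ} (hf : IsDerivChain f) (n : ℕ) :
    ContinuousOn (f n) (Set.Icc (-1) 1) :=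
  fun t ht => (hf n t ht).continuousAt.continuousWithinAt

/-- Leibniz' rule for t·f(t). For n = 0 the truncated index `n - 1` is harmless, since its
coefficient is zero. -/
theorem IsDerivChain.mul_id {f : ℕ → ℝ → ℝ} (hf : IsDerivChain f) :
    IsDerivChain fun n t => f n t * t + n * f (n - 1) t := by
  intro n t ht
  have h1 := (hf n t ht).mul (hasDerivAt_id' t)
  cases n with
  | zero =>
    have e : (fun t => f 0 t * t + (0 : ℕ) * f (0 - 1) t) = f 0 * fun t => t := by
      ext s
      simp
    exact (e ▸ h1).congr_deriv (by simp)
  | succ n =>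
    have h2 := (hf n t ht).const_mul ((n : ℝ) + 1)
    have e : (fun t => f (n + 1) t * t + (n + 1 : ℕ) * f (n + 1 - 1) t) =
        (f (n + 1) * fun t => t) + fun t => ((n : ℝ) + 1) * f n t := by
      ext s
      simp
    exact (e ▸ h1.add h2).congr_deriv (by simp; ring)

/-- The Rodrigues formula, in integrated form. -/
theorem integral_mul_gegenbauer {μ : ℝ} (hμ : 1 / 2 ≤ μ) (n : ℕ) {f : ℕ → ℝ → ℝ}
    (hf : IsDerivChain f) :
    ∫ t in (-1 : ℝ)..1, f 0 t * (gegenbauer μ n).eval t * (1 - t ^ 2) ^ (μ - 1 / 2) =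
      (gegenbauer μ n).eval 1 * rodriguesConst μ n *
        ∫ t in (-1 : ℝ)..1, f n t * (1 - t ^ 2) ^ (n + (μ - 1 / 2)) := by
  have hμ0 : 0 ≤ μ - 1 / 2 := by linarith
  have hI : Set.uIcc (-1 : ℝ) 1 = Set.Icc (-1) 1 := Set.uIcc_of_le (by norm_num)
  have hw : ∀ ν : ℝ, 0 ≤ ν → Continuous fun t : ℝ => (1 - t ^ 2) ^ ν := fun ν hν => by
    fun_prop (disch := exact hν)
  have hint : ∀ {g : ℝ → ℝ} {ν : ℝ}, 0 ≤ ν → ContinuousOn g (Set.Icc (-1) 1) →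
      IntervalIntegrable (fun t => g t * (1 - t ^ 2) ^ ν) MeasureTheory.volume (-1) 1 := by
    intro g ν hν hg
    exact ContinuousOn.intervalIntegrable (hI ▸ hg.mul (hw ν hν).continuousOn)
  -- The chain must vary: the term t·C_{m+1} of the recurrence is handled by the hypothesis for the
  -- chain of t·f.
  induction n using Nat.twoStepInduction generalizing f with
  | zero => simp [gegenbauer, rodriguesConst]
  | one =>
    have h := integral_mul_id_mul_weight hμ0 (hf 0) (hf.continuousOn 1)
    have e : (fun t : ℝ => f 0 t * (gegenbauer μ 1).eval t * (1 - t ^ 2) ^ (μ - 1 / 2)) =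
        fun t => 2 * μ * (f 0 t * t * (1 - t ^ 2) ^ (μ - 1 / 2)) := by
      ext t
      simp [gegenbauer]
      ring
    rw [e, intervalIntegral.integral_const_mul, h]
    simp only [gegenbauer, rodriguesConst, Polynomial.eval_mul, Polynomial.eval_C,
      Polynomial.eval_X, Finset.prod_range_one, Nat.cast_zero, Nat.cast_one, zero_add]
    rw [add_comm (1 : ℝ), show 2 * (μ - 1 / 2 + 1) = 2 * 0 + 2 * μ + 1 by ring]
    ring
  | more m ih0 ih1 =>
    have hn : (m : ℝ) + 2 ≠ 0 := by positivity
    have hm : (0 : ℝ) ≤ m := by positivity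
    set ν : ℝ := m + (μ - 1 / 2) with hν
    have hν0 : 0 ≤ ν := by positivity
    have h0 := ih0 hf
    have h1 := ih1 hf.mul_id
    have e1 : ((m + 1 : ℕ) : ℝ) + (μ - 1 / 2) = ν + 1 := by rw [hν]; push_cast; ring
    have e2 : ((m + 2 : ℕ) : ℝ) + (μ - 1 / 2) = ν + 1 + 1 := by rw [hν]; push_cast; ring
    rw [e1] at h1
    rw [e2]
    have hZ := integral_deriv_mul_id_mul_weight hν0 (hf m) (hf.continuousOn (m + 1))
    have hK := integral_mul_id_mul_weight (by positivity : 0 ≤ ν + 1) (hf (m + 1))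
      (hf.continuousOn (m + 2))
    have hrec : ((m : ℝ) + 2) * ∫ t in (-1 : ℝ)..1, f 0 t * (gegenbauer μ (m + 2)).eval t *
          (1 - t ^ 2) ^ (μ - 1 / 2) =
        2 * (m + 1 + μ) * (∫ t in (-1 : ℝ)..1, (f 0 t * t + (0 : ℕ) * f (0 - 1) t) *
          (gegenbauer μ (m + 1)).eval t * (1 - t ^ 2) ^ (μ - 1 / 2)) -
        (m + 2 * μ) * ∫ t in (-1 : ℝ)..1, f 0 t * (gegenbauer μ m).eval t *
          (1 - t ^ 2) ^ (μ - 1 / 2) := by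
      simp only [← intervalIntegral.integral_const_mul]
      rw [← intervalIntegral.integral_sub]
      · congr 1
        ext t
        have := gegenbauer_eval_add_two μ m t
        simp only [Nat.cast_zero, zero_mul, add_zero]
        linear_combination f 0 t * (1 - t ^ 2) ^ (μ - 1 / 2) * this
      · refine IntervalIntegrable.const_mul
          (hint (g := fun t => (f 0 t * t + (0 : ℕ) * f (0 - 1) t) * _) hμ0 ?_) _
        exact (hf.mul_id.continuousOn 0).mul (Polynomial.continuous _).continuousOn
      · refine IntervalIntegrable.const_mul (hint (g := fun t => f 0 t * _) hμ0 ?_) _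
        exact (hf.continuousOn 0).mul (Polynomial.continuous _).continuousOn
    have hsplit : ∫ t in (-1 : ℝ)..1, (f (m + 1) t * t + ((m + 1 : ℕ) : ℝ) * f (m + 1 - 1) t) *
          (1 - t ^ 2) ^ (ν + 1) =
        (∫ t in (-1 : ℝ)..1, f (m + 1) t * t * (1 - t ^ 2) ^ (ν + 1)) +
          ((m : ℝ) + 1) * ∫ t in (-1 : ℝ)..1, f m t * (1 - t ^ 2) ^ (ν + 1) := by
      rw [← intervalIntegral.integral_const_mul, ← intervalIntegral.integral_add]
      · congr 1
        ext t
        simp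
        ring
      · exact hint (g := fun t => f (m + 1) t * t) (by positivity)
          ((hf.continuousOn _).mul continuousOn_id)
      · exact (hint (by positivity) (hf.continuousOn _)).const_mul _
    rw [hsplit] at h1
    -- From here on the argument is linear in the integrals: `hZ` eliminates Y, the ratio of
    -- C_{m+1}(1) to C_m(1) cancels X, and `hK` rewrites Z as a multiple of K.
    rw [h0, h1] at hrec
    generalize (∫ t in (-1 : ℝ)..1, f 0 t * (gegenbauer μ (m + 2)).eval t *
      (1 - t ^ 2) ^ (μ - 1 / 2)) = I at hrec ⊢
    generalize (∫ t in (-1 : ℝ)..1, f (m + 1) t * t * (1 - t ^ 2) ^ (ν + 1)) = Z at hrec hZ hK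
    generalize (∫ t in (-1 : ℝ)..1, f m t * (1 - t ^ 2) ^ (ν + 1)) = Y at hrec hZ
    generalize (∫ t in (-1 : ℝ)..1, f m t * (1 - t ^ 2) ^ ν) = X at hrec hZ
    generalize (∫ t in (-1 : ℝ)..1, f (m + 2) t * (1 - t ^ 2) ^ (ν + 1 + 1)) = K at hK ⊢
    have g1 := gegenbauer_eval_one_succ μ m
    have g2 := gegenbauer_eval_one_succ μ (m + 1)
    have r1 := rodriguesConst_succ μ m
    have r2 := rodriguesConst_succ μ (m + 1)
    push_cast at g2 r2
    have p1 : 2 * (m : ℝ) + 2 * μ + 1 ≠ 0 := by positivity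
    have p2 : 2 * ((m : ℝ) + 1) + 2 * μ + 1 ≠ 0 := by positivity
    have p3 : 2 * (ν + 1 + 1) = 2 * ((m : ℝ) + 1) + 2 * μ + 1 := by rw [hν]; ring
    have hνm : 2 * ν + 1 = 2 * m + 2 * μ := by rw [hν]; ring
    rw [p3] at hK
    generalize (gegenbauer μ (m + 2)).eval 1 = E2 at *
    generalize (gegenbauer μ (m + 1)).eval 1 = E1 at *
    generalize (gegenbauer μ m).eval 1 = E0 at *
    generalize rodriguesConst μ m = R0 at *
    have hK' : (2 * ((m : ℝ) + 1) + 2 * μ + 1)⁻¹ * K = Z := hK.symm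
    have r1' : R0 = rodriguesConst μ (m + 1) * (2 * (m : ℝ) + 2 * μ + 1) := by
      rw [r1]; field_simp
    rw [r2, show E2 * (rodriguesConst μ (m + 1) * (2 * ((m : ℝ) + 1) + 2 * μ + 1)⁻¹) * K =
      E2 * rodriguesConst μ (m + 1) * ((2 * ((m : ℝ) + 1) + 2 * μ + 1)⁻¹ * K) by ring, hK']
    rw [r1'] at hrec
    generalize rodriguesConst μ (m + 1) = R1 at *
    have hνe : ν = m + μ - 1 / 2 := by linarith
    rw [hνe] at hZ
    apply mul_left_cancel₀ hn
    rw [hrec]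
    linear_combination (-R1 * Z) * g2 + ((2 * m + 2 * μ + 1) * R1 * X) * g1 + (m + 1) * E1 * R1 * hZ

/-! ### Weighted means of functions on the half-plane -/

/-- Open subsets of the upper half-plane that are stable under horizontal dilations. -/
structure IsDilationDomain (Ξ : Set ℂ) : Prop where
  isOpen : IsOpen Ξ
  im_pos : ∀ z ∈ Ξ, 0 < z.im
  dilate : ∀ z ∈ Ξ, ∀ t ∈ Set.Icc (-1 : ℝ) 1, (⟨z.re * t, z.im⟩ : ℂ) ∈ Ξ

/-- The derivative in the real direction. -/
def horizDeriv (w : ℂ → ℝ) (z : ℂ) : ℝ := fderiv ℝ w z 1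

/-- The operator `ρ⁻¹ ∂_ρ`, where `z = r + iρ`. -/
def radDeriv (w : ℂ → ℝ) (z : ℂ) : ℝ := z.im⁻¹ * fderiv ℝ w z Complex.I

/-! ### Calculus of ∂_r and ρ⁻¹∂_ρ on the half-plane. -/

section Operators

variable {Ξ : Set ℂ} {w w₁ w₂ : ℂ → ℝ}

theorem contDiffOn_fderiv_apply (hΞ : IsDilationDomain Ξ) (hw : ContDiffOn ℝ ∞ w Ξ) (v : ℂ) :
    ContDiffOn ℝ ∞ (fun z => fderiv ℝ w z v) Ξ :=
  (hw.fderiv_of_isOpen hΞ.isOpen (m := ∞) (by simp)).clm_apply contDiffOn_const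

theorem contDiffOn_im (s : Set ℂ) : ContDiffOn ℝ ∞ (fun z : ℂ => z.im) s :=
  Complex.imCLM.contDiff.contDiffOn

theorem contDiffOn_inv_im (hΞ : IsDilationDomain Ξ) : ContDiffOn ℝ ∞ (fun z : ℂ => z.im⁻¹) Ξ :=
  (contDiffOn_im Ξ).inv fun z hz => (hΞ.im_pos z hz).ne'

theorem contDiffOn_horizDeriv (hΞ : IsDilationDomain Ξ) (hw : ContDiffOn ℝ ∞ w Ξ) :
    ContDiffOn ℝ ∞ (horizDeriv w) Ξ :=
  contDiffOn_fderiv_apply hΞ hw 1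

theorem contDiffOn_radDeriv (hΞ : IsDilationDomain Ξ) (hw : ContDiffOn ℝ ∞ w Ξ) :
    ContDiffOn ℝ ∞ (radDeriv w) Ξ :=
  (contDiffOn_inv_im hΞ).mul (contDiffOn_fderiv_apply hΞ hw Complex.I)

theorem contDiffOn_iterate_radDeriv (hΞ : IsDilationDomain Ξ) (hw : ContDiffOn ℝ ∞ w Ξ) (n : ℕ) :
    ContDiffOn ℝ ∞ (radDeriv^[n] w) Ξ := by
  induction n with
  | zero => exact hw
  | succ n ih =>
    rw [Function.iterate_succ_apply']
    exact contDiffOn_radDeriv hΞ ih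

theorem fderiv_eqOn (hΞ : IsDilationDomain Ξ) (h : Set.EqOn w₁ w₂ Ξ) {z : ℂ} (hz : z ∈ Ξ) :
    fderiv ℝ w₁ z = fderiv ℝ w₂ z :=
  (h.eventuallyEq_of_mem (hΞ.isOpen.mem_nhds hz)).fderiv_eq

theorem horizDeriv_eqOn (hΞ : IsDilationDomain Ξ) (h : Set.EqOn w₁ w₂ Ξ) :
    Set.EqOn (horizDeriv w₁) (horizDeriv w₂) Ξ := fun z hz => by
  rw [horizDeriv, horizDeriv, fderiv_eqOn hΞ h hz]

theorem radDeriv_eqOn (hΞ : IsDilationDomain Ξ) (h : Set.EqOn w₁ w₂ Ξ) :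
    Set.EqOn (radDeriv w₁) (radDeriv w₂) Ξ := fun z hz => by
  rw [radDeriv, radDeriv, fderiv_eqOn hΞ h hz]

theorem iterate_radDeriv_eqOn (hΞ : IsDilationDomain Ξ) (h : Set.EqOn w₁ w₂ Ξ) (n : ℕ) :
    Set.EqOn (radDeriv^[n] w₁) (radDeriv^[n] w₂) Ξ := by
  induction n with
  | zero => exact h
  | succ n ih =>
    simp only [Function.iterate_succ_apply']
    exact radDeriv_eqOn hΞ ih

theorem differentiableAt_of_mem (hΞ : IsDilationDomain Ξ) (hw : ContDiffOn ℝ ∞ w Ξ) {z : ℂ}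
    (hz : z ∈ Ξ) : DifferentiableAt ℝ w z :=
  (hw.contDiffAt (hΞ.isOpen.mem_nhds hz)).differentiableAt (by simp)

theorem fderiv_fderiv_apply_comm (hΞ : IsDilationDomain Ξ) (hw : ContDiffOn ℝ ∞ w Ξ) {z : ℂ}
    (hz : z ∈ Ξ) (v v' : ℂ) :
    fderiv ℝ (fun y => fderiv ℝ w y v) z v' = fderiv ℝ (fun y => fderiv ℝ w y v') z v := by
  have hc := hw.contDiffAt (hΞ.isOpen.mem_nhds hz)
  have hs : IsSymmSndFDerivAt ℝ w z := hc.isSymmSndFDerivAt (by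
    rw [minSmoothness_of_isRCLikeNormedField]
    exact WithTop.coe_le_coe.2 le_top)
  have hd : DifferentiableAt ℝ (fderiv ℝ w) z :=
    (hc.fderiv_right (m := ∞) (by simp)).differentiableAt (by simp)
  have h : ∀ v : ℂ, fderiv ℝ (fun y => fderiv ℝ w y v) z = (fderiv ℝ (fderiv ℝ w) z).flip v := by
    intro v
    ext v'
    rw [fderiv_clm_apply hd (differentiableAt_const v)]
    simp
  rw [h, h]
  exact hs v' v

theorem hasFDerivAt_inv_im {z : ℂ} (hz : z.im ≠ 0) :
    HasFDerivAt (fun z : ℂ => z.im⁻¹) (-(z.im ^ 2)⁻¹ • Complex.imCLM) z :=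
  (hasDerivAt_inv hz).comp_hasFDerivAt z Complex.imCLM.hasFDerivAt

/-- The factor ρ⁻¹ does not depend on r, and second derivatives are symmetric. -/
theorem horizDeriv_radDeriv (hΞ : IsDilationDomain Ξ) (hw : ContDiffOn ℝ ∞ w Ξ) :
    Set.EqOn (horizDeriv (radDeriv w)) (radDeriv (horizDeriv w)) Ξ := by
  intro z hz
  have h := (hasFDerivAt_inv_im (hΞ.im_pos z hz).ne').mul
    (differentiableAt_of_mem hΞ (contDiffOn_fderiv_apply hΞ hw Complex.I) hz).hasFDerivAt
  have h' : fderiv ℝ (radDeriv w) z = _ := h.fderiv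
  rw [horizDeriv, h', radDeriv]
  simp only [add_apply, smul_apply, Complex.imCLM_apply,
    Complex.one_im, smul_eq_mul, mul_zero, add_zero]
  rw [fderiv_fderiv_apply_comm hΞ hw hz]
  rfl

theorem horizDeriv_iterate_radDeriv (hΞ : IsDilationDomain Ξ) (hw : ContDiffOn ℝ ∞ w Ξ) (n : ℕ) :
    Set.EqOn (horizDeriv (radDeriv^[n] w)) (radDeriv^[n] (horizDeriv w)) Ξ := by
  induction n with
  | zero => exact fun _ _ => rfl
  | succ n ih =>
    simp only [Function.iterate_succ_apply']
    exact (horizDeriv_radDeriv hΞ (contDiffOn_iterate_radDeriv hΞ hw n)).trans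
      (radDeriv_eqOn hΞ ih)

/-- Since ρ⁻¹∂_ρ(ρ²) = 2, every application adds 2 to the lower coefficient. This is the origin of
the odd numbers 2n+1, one of which finally equals q + 2ℓ. -/
theorem radDeriv_im_sq_mul_add (hΞ : IsDilationDomain Ξ) (h₁ : ContDiffOn ℝ ∞ w₁ Ξ)
    (h₂ : ContDiffOn ℝ ∞ w₂ Ξ) (c : ℝ) :
    Set.EqOn (radDeriv fun z => z.im ^ 2 * w₁ z + c * w₂ z)
      (fun z => z.im ^ 2 * radDeriv w₁ z + (2 * w₁ z + c * radDeriv w₂ z)) Ξ := by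
  intro z hz
  have him := (hΞ.im_pos z hz).ne'
  have hsq : HasFDerivAt (fun z : ℂ => z.im ^ 2) ((2 * z.im) • Complex.imCLM) z := by
    exact ((hasDerivAt_pow 2 z.im).comp_hasFDerivAt z Complex.imCLM.hasFDerivAt).congr_fderiv
      (by simp)
  have h := (hsq.mul (differentiableAt_of_mem hΞ h₁ hz).hasFDerivAt).add
    ((differentiableAt_of_mem hΞ h₂ hz).hasFDerivAt.const_mul c)
  have h' : fderiv ℝ (fun z => z.im ^ 2 * w₁ z + c * w₂ z) z = _ := h.fderiv
  simp only [radDeriv, h']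
  simp only [add_apply, smul_apply, Complex.imCLM_apply,
    Complex.I_im, smul_eq_mul, mul_one]
  field_simp
  ring

/-- Iterates of `ρ⁻¹ ∂_ρ` on `ρ ∂_ρ φ + φ`. -/
theorem iterate_radDeriv_im_sq_mul_radDeriv_add (hΞ : IsDilationDomain Ξ)
    (hw : ContDiffOn ℝ ∞ w Ξ) (n : ℕ) :
    Set.EqOn (radDeriv^[n] fun z => z.im ^ 2 * radDeriv w z + w z)
      (fun z => z.im ^ 2 * radDeriv^[n + 1] w z + (2 * n + 1) * radDeriv^[n] w z) Ξ := by
  induction n with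
  | zero => intro z _; simp
  | succ n ih =>
    intro z hz
    rw [Function.iterate_succ_apply', radDeriv_eqOn hΞ ih hz,
      radDeriv_im_sq_mul_add hΞ (contDiffOn_iterate_radDeriv hΞ hw _)
        (contDiffOn_iterate_radDeriv hΞ hw _) _ hz]
    simp only [← Function.iterate_succ_apply' radDeriv]
    push_cast
    ring

end Operators

/-! ### Cauchy–Riemann equations under iterates of ρ⁻¹∂_ρ. -/

/-- Conjugate harmonic functions. -/
structure IsConjugatePair (Ξ : Set ℂ) (u v : ℂ → ℝ) : Prop where
  left : ContDiffOn ℝ ∞ u Ξ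
  right : ContDiffOn ℝ ∞ v Ξ
  re_im : ∀ z ∈ Ξ, fderiv ℝ u z 1 = fderiv ℝ v z Complex.I
  im_re : ∀ z ∈ Ξ, fderiv ℝ u z Complex.I = -fderiv ℝ v z 1

/-- The function `ρ⁻¹ ∂_r v`. -/
def slope (v : ℂ → ℝ) (z : ℂ) : ℝ := z.im⁻¹ * horizDeriv v z

section Conjugate

variable {Ξ : Set ℂ} {u v : ℂ → ℝ}

theorem contDiffOn_slope (hΞ : IsDilationDomain Ξ) (hv : ContDiffOn ℝ ∞ v Ξ) :
    ContDiffOn ℝ ∞ (slope v) Ξ :=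
  (contDiffOn_inv_im hΞ).mul (contDiffOn_horizDeriv hΞ hv)

/-- One Cauchy–Riemann equation reads ρ⁻¹∂_ρ u = -ρ⁻¹∂_r v; the remaining n operators are applied to
both sides. -/
theorem IsConjugatePair.iterate_radDeriv_succ (hΞ : IsDilationDomain Ξ)
    (h : IsConjugatePair Ξ u v) (n : ℕ) :
    Set.EqOn (radDeriv^[n + 1] u) (fun z => -radDeriv^[n] (slope v) z) Ξ := by
  induction n with
  | zero =>
    intro z hz
    simp [radDeriv, slope, horizDeriv, h.im_re z hz]
  | succ n ih =>
    intro z hz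
    rw [Function.iterate_succ_apply', radDeriv_eqOn hΞ ih hz, Function.iterate_succ_apply']
    simp only [radDeriv, fderiv_fun_neg, neg_apply, mul_neg]

/-- With s = ρ⁻¹∂_r v one has ∂_r²u = ∂_r∂_ρ v = ∂_ρ(ρ s), which the product rule expands. -/
theorem IsConjugatePair.horizDeriv_horizDeriv (hΞ : IsDilationDomain Ξ)
    (h : IsConjugatePair Ξ u v) :
    Set.EqOn (horizDeriv (horizDeriv u))
      (fun z => z.im ^ 2 * radDeriv (slope v) z + slope v z) Ξ := by
  intro z hz
  have him := (hΞ.im_pos z hz).ne'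
  have e1 : Set.EqOn (horizDeriv u) (fun z => fderiv ℝ v z Complex.I) Ξ := h.re_im
  have h2 := (hasFDerivAt_inv_im him).mul
    (differentiableAt_of_mem hΞ (contDiffOn_horizDeriv hΞ h.right) hz).hasFDerivAt
  have h2' : fderiv ℝ (slope v) z = _ := h2.fderiv
  rw [horizDeriv_eqOn hΞ e1 hz, horizDeriv, fderiv_fderiv_apply_comm hΞ h.right hz]
  simp only [radDeriv, h2']
  simp only [add_apply, smul_apply, Complex.imCLM_apply,
    Complex.I_im, smul_eq_mul, mul_one, slope]
  change fderiv ℝ (horizDeriv v) z Complex.I = _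
  field_simp
  ring

theorem IsConjugatePair.horizDeriv_horizDeriv_iterate (hΞ : IsDilationDomain Ξ)
    (h : IsConjugatePair Ξ u v) (n : ℕ) :
    Set.EqOn (horizDeriv (horizDeriv (radDeriv^[n] u)))
      (fun z => z.im ^ 2 * radDeriv^[n + 1] (slope v) z +
        (2 * n + 1) * radDeriv^[n] (slope v) z) Ξ :=
  ((horizDeriv_eqOn hΞ (horizDeriv_iterate_radDeriv hΞ h.left n)).trans
    (horizDeriv_iterate_radDeriv hΞ (contDiffOn_horizDeriv hΞ h.left) n)).trans
    ((iterate_radDeriv_eqOn hΞ (h.horizDeriv_horizDeriv hΞ) n).trans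
      (iterate_radDeriv_im_sq_mul_radDeriv_add hΞ (contDiffOn_slope hΞ h.right) n))

end Conjugate

/-! ### Recursion and differentiation of weighted means. -/

/-- The mean `∫_{-1}^{1} w(rt, ρ) (1 - t²)^μ dt`. -/
def weightedMean (μ : ℝ) (w : ℂ → ℝ) (r ρ : ℝ) : ℝ :=
  ∫ t in (-1 : ℝ)..1, w ⟨r * t, ρ⟩ * (1 - t ^ 2) ^ μ

section Mean

variable {Ξ : Set ℂ} {w w₁ w₂ : ℂ → ℝ} {μ : ℝ}

theorem continuous_weight (hμ : 0 ≤ μ) : Continuous fun t : ℝ => (1 - t ^ 2) ^ μ := by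
  fun_prop (disch := exact hμ)

theorem continuous_dilate : Continuous fun y : ℂ × ℝ => (⟨y.1.re * y.2, y.1.im⟩ : ℂ) := by
  have : (fun y : ℂ × ℝ => (⟨y.1.re * y.2, y.1.im⟩ : ℂ)) =
      fun y => ((y.1.re * y.2 : ℝ) : ℂ) + (y.1.im : ℂ) * Complex.I := by
    ext y
    apply Complex.ext <;> simp
  rw [this]
  fun_prop

theorem continuousOn_comp_dilate (hΞ : IsDilationDomain Ξ) {F : Type*} [TopologicalSpace F]
    {g : ℂ → F} (hg : ContinuousOn g Ξ) :
    ContinuousOn (fun y : ℂ × ℝ => g ⟨y.1.re * y.2, y.1.im⟩) (Ξ ×ˢ Set.Icc (-1) 1) :=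
  hg.comp continuous_dilate.continuousOn fun _ hy => hΞ.dilate _ hy.1 _ hy.2

theorem continuousOn_comp_dilate_right (hΞ : IsDilationDomain Ξ) {F : Type*} [TopologicalSpace F]
    {g : ℂ → F} (hg : ContinuousOn g Ξ) {z : ℂ} (hz : z ∈ Ξ) :
    ContinuousOn (fun t : ℝ => g ⟨z.re * t, z.im⟩) (Set.Icc (-1) 1) :=
  (continuousOn_comp_dilate hΞ hg).comp (f := fun t : ℝ => (z, t)) (by fun_prop)
    fun t ht => ⟨hz, ht⟩

theorem uIcc_neg_one_one : Set.uIcc (-1 : ℝ) 1 = Set.Icc (-1) 1 := Set.uIcc_of_le (by norm_num)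

theorem intervalIntegrable_weightedMean (hΞ : IsDilationDomain Ξ) (hμ : 0 ≤ μ)
    (hw : ContinuousOn w Ξ) {z : ℂ} (hz : z ∈ Ξ) :
    IntervalIntegrable (fun t : ℝ => w ⟨z.re * t, z.im⟩ * (1 - t ^ 2) ^ μ) MeasureTheory.volume
      (-1) 1 :=
  ContinuousOn.intervalIntegrable (uIcc_neg_one_one ▸
    (continuousOn_comp_dilate_right hΞ hw hz).mul (continuous_weight hμ).continuousOn)

theorem weightedMean_congr (hΞ : IsDilationDomain Ξ) (h : Set.EqOn w₁ w₂ Ξ) {z : ℂ}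
    (hz : z ∈ Ξ) : weightedMean μ w₁ z.re z.im = weightedMean μ w₂ z.re z.im := by
  refine intervalIntegral.integral_congr fun t ht => ?_
  rw [uIcc_neg_one_one] at ht
  simp only [h (hΞ.dilate z hz t ht)]

theorem weightedMean_neg (r ρ : ℝ) :
    weightedMean μ (fun z => -w z) r ρ = -weightedMean μ w r ρ := by
  simp [weightedMean]

theorem weightedMean_im_sq_mul_add (hΞ : IsDilationDomain Ξ) (hμ : 0 ≤ μ)
    (h₁ : ContinuousOn w₁ Ξ) (h₂ : ContinuousOn w₂ Ξ) (c : ℝ) {z : ℂ} (hz : z ∈ Ξ) :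
    weightedMean μ (fun z => z.im ^ 2 * w₁ z + c * w₂ z) z.re z.im =
      z.im ^ 2 * weightedMean μ w₁ z.re z.im + c * weightedMean μ w₂ z.re z.im := by
  simp only [weightedMean]
  rw [← intervalIntegral.integral_const_mul, ← intervalIntegral.integral_const_mul,
    ← intervalIntegral.integral_add
      ((intervalIntegrable_weightedMean hΞ hμ h₁ hz).const_mul _)
      ((intervalIntegrable_weightedMean hΞ hμ h₂ hz).const_mul _)]
  congr 1
  ext t
  ring

theorem hasDerivAt_comp_dilate (hΞ : IsDilationDomain Ξ) (hw : ContDiffOn ℝ ∞ w Ξ) {z : ℂ}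
    (hz : z ∈ Ξ) {t : ℝ} (ht : t ∈ Set.Icc (-1 : ℝ) 1) :
    HasDerivAt (fun t : ℝ => w ⟨z.re * t, z.im⟩) (z.re * horizDeriv w ⟨z.re * t, z.im⟩) t := by
  have h1 : HasDerivAt (fun t : ℝ => (⟨z.re * t, z.im⟩ : ℂ)) (z.re : ℂ) t := by
    have : (fun t : ℝ => (⟨z.re * t, z.im⟩ : ℂ)) =
        fun t : ℝ => (t : ℂ) * (z.re : ℂ) + (z.im : ℂ) * Complex.I := by
      ext y
      apply Complex.ext <;> simp [mul_comm]
    rw [this]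
    exact (((hasDerivAt_id' t).ofReal_comp.mul_const (z.re : ℂ)).add_const
      ((z.im : ℂ) * Complex.I)).congr_deriv (by simp)
  have h2 := (differentiableAt_of_mem hΞ hw (hΞ.dilate z hz t ht)).hasFDerivAt.comp_hasDerivAt t h1
  refine h2.congr_deriv ?_
  have : (z.re : ℂ) = z.re • (1 : ℂ) := by simp
  rw [this, map_smul]
  rfl

theorem continuousOn_horiz_comp (hΞ : IsDilationDomain Ξ) (hw : ContDiffOn ℝ ∞ w Ξ) {z : ℂ}
    (hz : z ∈ Ξ) :
    ContinuousOn (fun t : ℝ => z.re * horizDeriv w ⟨z.re * t, z.im⟩) (Set.Icc (-1) 1) :=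
  continuousOn_const.mul
    (continuousOn_comp_dilate_right hΞ (contDiffOn_horizDeriv hΞ hw).continuousOn hz)

/-- Integration by parts trades the odd factor t for a factor r from the chain rule and a larger
weight. That r is what keeps r⁻¹∂_r of a mean regular at r = 0. -/
theorem integral_comp_dilate_mul_id (hΞ : IsDilationDomain Ξ) (hμ : 0 ≤ μ)
    (hw : ContDiffOn ℝ ∞ w Ξ) {z : ℂ} (hz : z ∈ Ξ) :
    ∫ t in (-1 : ℝ)..1, w ⟨z.re * t, z.im⟩ * t * (1 - t ^ 2) ^ μ =
      (2 * (μ + 1))⁻¹ * (z.re * weightedMean (μ + 1) (horizDeriv w) z.re z.im) := by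
  rw [integral_mul_id_mul_weight hμ (fun t ht => hasDerivAt_comp_dilate hΞ hw hz ht)
    (continuousOn_horiz_comp hΞ hw hz), weightedMean, ← intervalIntegral.integral_const_mul z.re]
  simp only [mul_assoc]

/-- The recursion in `μ` of the weighted means. -/
theorem weightedMean_eq (hΞ : IsDilationDomain Ξ) (hμ : 0 ≤ μ)
    (hw : ContDiffOn ℝ ∞ w Ξ) {z : ℂ} (hz : z ∈ Ξ) :
    weightedMean μ w z.re z.im = (2 * (μ + 1))⁻¹ *
      (z.re ^ 2 * ((2 * (μ + 1 + 1))⁻¹ *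
          weightedMean (μ + 1 + 1) (horizDeriv (horizDeriv w)) z.re z.im) +
        (2 * μ + 3) * weightedMean (μ + 1) w z.re z.im) := by
  have h1 := integral_deriv_mul_id_mul_weight hμ
    (fun t ht => hasDerivAt_comp_dilate hΞ hw hz ht) (continuousOn_horiz_comp hΞ hw hz)
  have h2 := integral_comp_dilate_mul_id hΞ (by positivity : 0 ≤ μ + 1)
    (contDiffOn_horizDeriv hΞ hw) hz
  have h3 : ∫ t in (-1 : ℝ)..1, z.re * horizDeriv w ⟨z.re * t, z.im⟩ * t * (1 - t ^ 2) ^ (μ + 1) =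
      z.re * ∫ t in (-1 : ℝ)..1, horizDeriv w ⟨z.re * t, z.im⟩ * t * (1 - t ^ 2) ^ (μ + 1) := by
    rw [← intervalIntegral.integral_const_mul]
    simp only [mul_assoc]
  rw [h3, h2] at h1
  change _ = 2 * (μ + 1) * weightedMean μ w z.re z.im -
    (2 * μ + 3) * weightedMean (μ + 1) w z.re z.im at h1
  have h0 : 2 * (μ + 1) ≠ 0 := by positivity
  field_simp at h1 ⊢
  linear_combination -h1

/-- The linear map `z ↦ (t Re z, Im z)`. -/
def dilateCLM (t : ℝ) : ℂ →L[ℝ] ℂ :=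
  t • Complex.reCLM.smulRight (1 : ℂ) + Complex.imCLM.smulRight Complex.I

theorem dilateCLM_apply (t : ℝ) (z : ℂ) : dilateCLM t z = ⟨z.re * t, z.im⟩ := by
  apply Complex.ext <;> simp [dilateCLM, mul_comm]

theorem continuous_dilateCLM : Continuous dilateCLM := by
  unfold dilateCLM
  fun_prop

/-- Differentiation under the integral sign, followed by an integration by parts that exhibits the
factor r in the r-derivative, as `hasFDerivAt_comp_radii` requires. -/
theorem hasFDerivAt_weightedMean (hΞ : IsDilationDomain Ξ) (hμ : 0 ≤ μ)
    (hw : ContDiffOn ℝ ∞ w Ξ) {z : ℂ} (hz : z ∈ Ξ) :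
    HasFDerivAt (fun z : ℂ => weightedMean μ w z.re z.im)
      ((z.re * ((2 * (μ + 1))⁻¹ *
          weightedMean (μ + 1) (horizDeriv (horizDeriv w)) z.re z.im)) • Complex.reCLM +
        (z.im * weightedMean μ (radDeriv w) z.re z.im) • Complex.imCLM) z := by
  set F' : ℂ → ℝ → ℂ →L[ℝ] ℝ := fun y t =>
    ((1 - t ^ 2) ^ μ) • (fderiv ℝ w ⟨y.re * t, y.im⟩).comp (dilateCLM t) with hF'
  have hfc : ContinuousOn (fderiv ℝ w) Ξ := hw.continuousOn_fderiv_of_isOpen hΞ.isOpen (by simp)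
  have hF'c : ContinuousOn (fun y : ℂ × ℝ => F' y.1 y.2) (Ξ ×ˢ Set.Icc (-1) 1) := by
    refine ContinuousOn.smul ((continuous_weight hμ).comp continuous_snd).continuousOn ?_
    exact (continuousOn_comp_dilate hΞ hfc).clm_comp
      (continuous_dilateCLM.comp continuous_snd).continuousOn
  -- Compactness of a closed ball in Ξ times [-1, 1] gives a constant dominating the derivative of
  -- the integrand.
  obtain ⟨ε, hε, hball⟩ := Metric.nhds_basis_closedBall.mem_iff.1 (hΞ.isOpen.mem_nhds hz)
  obtain ⟨C, hC⟩ := ((isCompact_closedBall z ε).prod (isCompact_Icc (a := (-1 : ℝ)) (b := 1)))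
    |>.exists_bound_of_continuousOn (hF'c.mono (Set.prod_mono_left hball))
  have hIoc : Set.uIoc (-1 : ℝ) 1 ⊆ Set.Icc (-1) 1 := by
    rw [Set.uIoc_of_le (by norm_num)]
    exact Set.Ioc_subset_Icc_self
  have hF'z : ContinuousOn (F' z) (Set.Icc (-1) 1) :=
    hF'c.comp (f := fun t : ℝ => (z, t)) (by fun_prop) fun t ht => ⟨hz, ht⟩
  have key := intervalIntegral.hasFDerivAt_integral_of_dominated_of_fderiv_le (𝕜 := ℝ)
    (μ := MeasureTheory.volume) (a := -1) (b := 1)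
    (F := fun (y : ℂ) (t : ℝ) => w ⟨y.re * t, y.im⟩ * (1 - t ^ 2) ^ μ) (F' := F') (x₀ := z)
    (s := Metric.closedBall z ε) (bound := fun _ => C) (Metric.closedBall_mem_nhds z hε)
    (by
      filter_upwards [hΞ.isOpen.mem_nhds hz] with y hy
      exact (intervalIntegrable_weightedMean hΞ hμ hw.continuousOn hy).def'.aestronglyMeasurable)
    (intervalIntegrable_weightedMean hΞ hμ hw.continuousOn hz)
    ((ContinuousOn.intervalIntegrable (uIcc_neg_one_one ▸ hF'z)).def'.aestronglyMeasurable)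
    (Filter.Eventually.of_forall fun t ht y hy => hC (y, t) ⟨hy, hIoc ht⟩)
    intervalIntegrable_const
    (by
      refine Filter.Eventually.of_forall fun t ht y hy => ?_
      have h1 := (differentiableAt_of_mem hΞ hw
        (hΞ.dilate y (hball hy) t (hIoc ht))).hasFDerivAt
      rw [← dilateCLM_apply] at h1
      have h2 := (h1.comp y (dilateCLM t).hasFDerivAt).mul_const ((1 - t ^ 2) ^ μ)
      simpa only [Function.comp_def, dilateCLM_apply] using h2)
  refine key.congr_fderiv ?_
  refine ContinuousLinearMap.ext fun v => ?_
  rw [ContinuousLinearMap.intervalIntegral_apply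
    (ContinuousOn.intervalIntegrable (uIcc_neg_one_one ▸ hF'z))]
  have e : ∀ t ∈ Set.uIcc (-1 : ℝ) 1, F' z t v =
      v.re * (horizDeriv w ⟨z.re * t, z.im⟩ * t * (1 - t ^ 2) ^ μ) +
        v.im * z.im * (radDeriv w ⟨z.re * t, z.im⟩ * (1 - t ^ 2) ^ μ) := by
    intro t _
    have hv : dilateCLM t v = (v.re * t) • (1 : ℂ) + v.im • Complex.I := by
      rw [dilateCLM_apply]
      apply Complex.ext <;> simp
    have him := (hΞ.im_pos z hz).ne'
    simp only [hF', smul_apply, ContinuousLinearMap.comp_apply, hv, map_add,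
      map_smul, smul_eq_mul, horizDeriv, radDeriv]
    field_simp
  rw [intervalIntegral.integral_congr e, intervalIntegral.integral_add,
    intervalIntegral.integral_const_mul, intervalIntegral.integral_const_mul,
    integral_comp_dilate_mul_id hΞ hμ (contDiffOn_horizDeriv hΞ hw) hz]
  · simp only [add_apply, smul_apply, Complex.reCLM_apply,
      Complex.imCLM_apply, smul_eq_mul]
    rw [weightedMean, weightedMean]
    ring
  · refine IntervalIntegrable.const_mul (ContinuousOn.intervalIntegrable (uIcc_neg_one_one ▸ ?_)) _
    exact ((continuousOn_comp_dilate_right hΞ (contDiffOn_horizDeriv hΞ hw).continuousOn hz).mul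
      continuousOn_id).mul (continuous_weight hμ).continuousOn
  · exact (intervalIntegrable_weightedMean hΞ hμ
      (contDiffOn_radDeriv hΞ hw).continuousOn hz).const_mul _

end Mean

/-! ### Biradial functions -/

section Forms

variable {σ : Type} [Fintype σ]

/-- The quadratic form `∑ⱼ χⱼ xⱼ²`. -/
def sqForm (χ : σ → ℝ) (X : EuclideanSpace ℝ σ) : ℝ := ∑ j, χ j * X j ^ 2

/-- Half the derivative of `sqForm χ`. -/
def gradForm (χ : σ → ℝ) (X : EuclideanSpace ℝ σ) : EuclideanSpace ℝ σ →L[ℝ] ℝ :=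
  ∑ j, (χ j * X j) • EuclideanSpace.proj j

theorem hasFDerivAt_sqForm (χ : σ → ℝ) (X : EuclideanSpace ℝ σ) :
    HasFDerivAt (sqForm χ) ((2 : ℝ) • gradForm χ X) X := by
  have h : ∀ j ∈ Finset.univ, HasFDerivAt (fun X : EuclideanSpace ℝ σ => χ j * X j ^ 2)
      ((2 * (χ j * X j)) • EuclideanSpace.proj (𝕜 := ℝ) j) X := fun j _ => by
    have h1 : HasFDerivAt (fun X : EuclideanSpace ℝ σ => X j)
      (EuclideanSpace.proj (𝕜 := ℝ) j) X := (EuclideanSpace.proj (𝕜 := ℝ) j).hasFDerivAt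
    refine (((hasDerivAt_pow 2 (X j)).comp_hasFDerivAt X h1).const_mul (χ j)).congr_fderiv ?_
    rw [smul_smul]
    congr 1
    simp
    ring
  refine (HasFDerivAt.fun_sum h).congr_fderiv ?_
  rw [gradForm, Finset.smul_sum]
  simp only [smul_smul]

theorem contDiff_gradForm (χ : σ → ℝ) {n : WithTop ℕ∞} : ContDiff ℝ n (gradForm χ) := by
  unfold gradForm
  fun_prop

theorem gradForm_single [DecidableEq σ] (χ : σ → ℝ) (X : EuclideanSpace ℝ σ) (j : σ) :
    gradForm χ X (EuclideanSpace.single j 1) = χ j * X j := by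
  simp only [gradForm, sum_apply, smul_apply, PiLp.proj_apply, smul_eq_mul]
  rw [Finset.sum_eq_single j] <;> simp +contextual [eq_comm]

end Forms

variable {p q : ℕ}

/-- The characteristic function of the indices of `ℝ^p`. -/
def leftInd (p q : ℕ) : Fin p ⊕ Fin q → ℝ := Sum.elim 1 0

/-- The characteristic function of the indices of `ℝ^q`. -/
def rightInd (p q : ℕ) : Fin p ⊕ Fin q → ℝ := Sum.elim 0 1

theorem norm_xPart_sq (X : EuclideanSpace ℝ (Fin p ⊕ Fin q)) :
    ‖xPart X‖ ^ 2 = sqForm (leftInd p q) X := by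
  simp [EuclideanSpace.real_norm_sq_eq, sqForm, leftInd, xPart]

theorem norm_yPart_sq (X : EuclideanSpace ℝ (Fin p ⊕ Fin q)) :
    ‖yPart X‖ ^ 2 = sqForm (rightInd p q) X := by
  simp [EuclideanSpace.real_norm_sq_eq, sqForm, rightInd, yPart]

/-- `xPart` as a continuous linear map. -/
def xPartCLM (p q : ℕ) : EuclideanSpace ℝ (Fin p ⊕ Fin q) →L[ℝ] EuclideanSpace ℝ (Fin p) :=
  LinearMap.toContinuousLinearMap
    { toFun := xPart, map_add' := fun _ _ => rfl, map_smul' := fun _ _ => rfl }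

/-- `yPart` as a continuous linear map. -/
def yPartCLM (p q : ℕ) : EuclideanSpace ℝ (Fin p ⊕ Fin q) →L[ℝ] EuclideanSpace ℝ (Fin q) :=
  LinearMap.toContinuousLinearMap
    { toFun := yPart, map_add' := fun _ _ => rfl, map_smul' := fun _ _ => rfl }

theorem coe_xPartCLM : ⇑(xPartCLM p q) = xPart := rfl

theorem coe_yPartCLM : ⇑(yPartCLM p q) = yPart := rfl

/-- The point `|x| + i|y|` of the closed quadrant. -/
def radii (X : EuclideanSpace ℝ (Fin p ⊕ Fin q)) : ℂ := ⟨‖xPart X‖, ‖yPart X‖⟩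

theorem continuous_radii : Continuous (radii : EuclideanSpace ℝ (Fin p ⊕ Fin q) → ℂ) := by
  have : (radii : EuclideanSpace ℝ (Fin p ⊕ Fin q) → ℂ) =
      fun X => (‖xPartCLM p q X‖ : ℂ) + (‖yPartCLM p q X‖ : ℂ) * Complex.I := by
    ext X
    apply Complex.ext <;> simp [radii, coe_xPartCLM, coe_yPartCLM]
  rw [this]
  fun_prop

theorem isOpen_biaxialRegion {Ξ : Set ℂ} (hΞ : IsOpen Ξ) : IsOpen (biaxialRegion p q Ξ) :=
  hΞ.preimage continuous_radii

/-- The map `radii` is not differentiable where x = 0. Its Lipschitz bound still suffices to compose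
it with a function whose derivative vanishes at the point. -/
theorem radii_sub_isBigO (X : EuclideanSpace ℝ (Fin p ⊕ Fin q)) :
    (fun Y => radii Y - radii X) =O[nhds X] fun Y => Y - X := by
  refine Asymptotics.IsBigO.of_bound (‖xPartCLM p q‖ + ‖yPartCLM p q‖)
    (Filter.Eventually.of_forall fun Y => ?_)
  refine (Complex.norm_le_abs_re_add_abs_im _).trans ?_
  rw [add_mul]
  have h : ∀ {n : ℕ} (L : EuclideanSpace ℝ (Fin p ⊕ Fin q) →L[ℝ] EuclideanSpace ℝ (Fin n)),
      |‖L Y‖ - ‖L X‖| ≤ ‖L‖ * ‖Y - X‖ := fun L => by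
    refine (abs_norm_sub_norm_le _ _).trans ?_
    rw [← map_sub]
    exact L.le_opNorm _
  exact add_le_add (h (xPartCLM p q)) (h (yPartCLM p q))

theorem hasFDerivAt_norm_yPart {X : EuclideanSpace ℝ (Fin p ⊕ Fin q)} (h : 0 < ‖yPart X‖) :
    HasFDerivAt (fun X : EuclideanSpace ℝ (Fin p ⊕ Fin q) => ‖yPart X‖)
      (‖yPart X‖⁻¹ • gradForm (rightInd p q) X) X := by
  have h1 : (fun X : EuclideanSpace ℝ (Fin p ⊕ Fin q) => ‖yPart X‖) =
      fun X => Real.sqrt (sqForm (rightInd p q) X) := by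
    ext Y
    rw [← norm_yPart_sq, Real.sqrt_sq (norm_nonneg _)]
  have h2 := (hasFDerivAt_sqForm (rightInd p q) X).sqrt (by rw [← norm_yPart_sq]; positivity)
  rw [h1]
  refine h2.congr_fderiv ?_
  rw [← norm_yPart_sq, Real.sqrt_sq (norm_nonneg _), smul_smul]
  congr 1
  field_simp

/-- If the `r`-derivative of `g` is `α r`, then `g(|x|, |y|)` is differentiable, also where
`x = 0`. -/
theorem hasFDerivAt_comp_radii {g : ℂ → ℝ} {X : EuclideanSpace ℝ (Fin p ⊕ Fin q)} {α β : ℝ}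
    (hy : 0 < ‖yPart X‖)
    (hg : HasFDerivAt g ((‖xPart X‖ * α) • Complex.reCLM + (‖yPart X‖ * β) • Complex.imCLM)
      (radii X)) :
    HasFDerivAt (fun X => g (radii X))
      (α • gradForm (leftInd p q) X + β • gradForm (rightInd p q) X) X := by
  -- The subtracted terms make the derivative at the point zero, and both are differentiable in X:
  -- r² is a polynomial in x, and ρ > 0.
  have h1 : HasFDerivAt (fun z : ℂ => g z - α / 2 * z.re ^ 2 - ‖yPart X‖ * β * z.im)
      (0 : ℂ →L[ℝ] ℝ) (radii X) := by
    have hre : HasFDerivAt (fun z : ℂ => z.re ^ 2) ((2 * ‖xPart X‖) • Complex.reCLM) (radii X) :=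
      ((hasDerivAt_pow 2 (radii X).re).comp_hasFDerivAt _
        Complex.reCLM.hasFDerivAt).congr_fderiv (by simp [radii])
    refine ((hg.sub (hre.const_mul (α / 2))).sub
      (Complex.imCLM.hasFDerivAt.const_mul (‖yPart X‖ * β))).congr_fderiv ?_
    ext v
    simp
    ring
  have h2 : HasFDerivAt (fun Y => g (radii Y) - α / 2 * (radii Y).re ^ 2 -
      ‖yPart X‖ * β * (radii Y).im) (0 : EuclideanSpace ℝ (Fin p ⊕ Fin q) →L[ℝ] ℝ) X := by
    rw [hasFDerivAt_iff_isLittleO] at h1 ⊢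
    have h3 := (h1.comp_tendsto continuous_radii.continuousAt).trans_isBigO (radii_sub_isBigO X)
    simpa [Function.comp_def] using h3
  have h4 := (h2.add ((hasFDerivAt_sqForm (leftInd p q) X).const_mul (α / 2))).add
    ((hasFDerivAt_norm_yPart hy).const_mul (‖yPart X‖ * β))
  have e : (fun X => g (radii X)) = ((fun Y => g (radii Y) - α / 2 * (radii Y).re ^ 2 -
      ‖yPart X‖ * β * (radii Y).im) + fun Y => α / 2 * sqForm (leftInd p q) Y) +
      fun Y : EuclideanSpace ℝ (Fin p ⊕ Fin q) => ‖yPart X‖ * β * ‖yPart Y‖ := by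
    ext Y
    simp only [← norm_xPart_sq, radii, Pi.add_apply]
    ring
  rw [e]
  refine h4.congr_fderiv ?_
  rw [zero_add, smul_smul, smul_smul]
  congr 2
  · ring
  · field_simp

/-! ### Smoothness of the means on ℝ^{p+q} and the Vekua-type system. -/

/-- The weighted mean as a function of `X = (x, y)`. -/
def meanField (μ : ℝ) (w : ℂ → ℝ) (X : EuclideanSpace ℝ (Fin p ⊕ Fin q)) : ℝ :=
  weightedMean μ w ‖xPart X‖ ‖yPart X‖

section MeanField

variable {Ξ : Set ℂ} {w u v : ℂ → ℝ} {μ : ℝ}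

theorem hasFDerivAt_meanField (hΞ : IsDilationDomain Ξ) (hμ : 0 ≤ μ)
    (hw : ContDiffOn ℝ ∞ w Ξ) {X : EuclideanSpace ℝ (Fin p ⊕ Fin q)}
    (hX : X ∈ biaxialRegion p q Ξ) :
    HasFDerivAt (meanField μ w)
      (((2 * (μ + 1))⁻¹ * meanField (μ + 1) (horizDeriv (horizDeriv w)) X) •
          gradForm (leftInd p q) X +
        meanField μ (radDeriv w) X • gradForm (rightInd p q) X) X :=
  hasFDerivAt_comp_radii (g := fun z => weightedMean μ w z.re z.im) (hΞ.im_pos _ hX)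
    (hasFDerivAt_weightedMean hΞ hμ hw hX)

/-- The coefficients of the derivative are again means of smooth functions, so the order is raised
by induction over all μ and w at once. -/
theorem contDiffOn_meanField (hΞ : IsDilationDomain Ξ) (hμ : 0 ≤ μ) (hw : ContDiffOn ℝ ∞ w Ξ) :
    ContDiffOn ℝ ∞ (meanField μ w) (biaxialRegion p q Ξ) := by
  rw [contDiffOn_infty]
  intro n
  induction n generalizing μ w with
  | zero =>
    refine contDiffOn_zero.2 fun X hX => ?_
    exact (hasFDerivAt_meanField hΞ hμ hw hX).continuousAt.continuousWithinAt
  | succ n ih =>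
    push_cast
    rw [contDiffOn_succ_iff_fderiv_of_isOpen (isOpen_biaxialRegion hΞ.isOpen)]
    refine ⟨fun X hX => (hasFDerivAt_meanField hΞ hμ hw hX).differentiableAt.differentiableWithinAt,
      fun h => absurd h (by simp), ?_⟩
    have h1 := ih (by positivity : 0 ≤ μ + 1)
      (contDiffOn_horizDeriv hΞ (contDiffOn_horizDeriv hΞ hw))
    have h2 := ih hμ (contDiffOn_radDeriv hΞ hw)
    exact (((contDiffOn_const.mul h1).smul (contDiff_gradForm _).contDiffOn).add
      (h2.smul (contDiff_gradForm _).contDiffOn)).congr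
      fun X hX => (hasFDerivAt_meanField hΞ hμ hw hX).fderiv

end MeanField

/-- Sequences `a n = (ρ⁻¹∂_ρ)ⁿ a 0`, `b n = (ρ⁻¹∂_ρ)ⁿ b 0` of biradial functions with
`r⁻¹∂_r`-derivatives `a' n`, `b' n`, where `A = a 0` and `B = r ρ b 0` satisfy the Vekua-type system
`∂_r A = ∂_ρ B`, `∂_ρ A = -∂_r B - (κ - 1) r⁻¹ B`. -/
structure IsVekuaSequence (Ω : Set (EuclideanSpace ℝ (Fin p ⊕ Fin q))) (κ : ℝ)
    (a b a' b' : ℕ → EuclideanSpace ℝ (Fin p ⊕ Fin q) → ℝ) : Prop where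
  smooth_left : ∀ n, ContDiffOn ℝ ∞ (a n) Ω
  smooth_right : ∀ n, ContDiffOn ℝ ∞ (b n) Ω
  deriv_left : ∀ n, ∀ X ∈ Ω, HasFDerivAt (a n)
    (a' n X • gradForm (leftInd p q) X + a (n + 1) X • gradForm (rightInd p q) X) X
  deriv_right : ∀ n, ∀ X ∈ Ω, HasFDerivAt (b n)
    (b' n X • gradForm (leftInd p q) X + b (n + 1) X • gradForm (rightInd p q) X) X
  horiz : ∀ n, ∀ X ∈ Ω,
    a' n X = sqForm (rightInd p q) X * b (n + 1) X + (2 * n + 1) * b n X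
  vert : ∀ n, ∀ X ∈ Ω, a (n + 1) X = -(sqForm (leftInd p q) X * b' n X + κ * b n X)

/-- The field `horiz` is the mean of the formula for ∂_r²(ρ⁻¹∂_ρ)ⁿu. The field `vert` combines a
Cauchy–Riemann equation with the recursion `weightedMean_eq`, whose coefficient 2μ + 3 becomes κ. -/
theorem IsConjugatePair.isVekuaSequence {Ξ : Set ℂ} {u v : ℂ → ℝ} {μ : ℝ}
    (h : IsConjugatePair Ξ u v) (hΞ : IsDilationDomain Ξ) (hμ : 0 ≤ μ) :
    IsVekuaSequence (biaxialRegion p q Ξ) (2 * μ + 3)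
      (fun n => meanField μ (radDeriv^[n] u))
      (fun n X => (2 * (μ + 1))⁻¹ * meanField (μ + 1) (radDeriv^[n] (slope v)) X)
      (fun n X => (2 * (μ + 1))⁻¹ *
        meanField (μ + 1) (horizDeriv (horizDeriv (radDeriv^[n] u))) X)
      (fun n X => (2 * (μ + 1))⁻¹ * ((2 * (μ + 1 + 1))⁻¹ *
        meanField (μ + 1 + 1) (horizDeriv (horizDeriv (radDeriv^[n] (slope v)))) X)) := by
  have hμ1 : 0 ≤ μ + 1 := by positivity
  have hu := contDiffOn_iterate_radDeriv hΞ h.left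
  have hv := contDiffOn_iterate_radDeriv hΞ (contDiffOn_slope hΞ h.right)
  refine ⟨fun n => contDiffOn_meanField hΞ hμ (hu n),
    fun n => contDiffOn_const.mul (contDiffOn_meanField hΞ hμ1 (hv n)), fun n X hX => ?_,
    fun n X hX => ?_, fun n X hX => ?_, fun n X hX => ?_⟩
  · rw [Function.iterate_succ_apply']
    exact hasFDerivAt_meanField hΞ hμ (hu n) hX
  · rw [Function.iterate_succ_apply']
    refine ((hasFDerivAt_meanField hΞ hμ1 (hv n) hX).const_mul _).congr_fderiv ?_
    rw [smul_add, smul_smul, smul_smul]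
  · have h1 := weightedMean_congr (μ := μ + 1) hΞ (h.horizDeriv_horizDeriv_iterate hΞ n) hX
    rw [weightedMean_im_sq_mul_add hΞ hμ1 (hv (n + 1)).continuousOn (hv n).continuousOn _ hX] at h1
    rw [← norm_yPart_sq]
    simp only [meanField]
    rw [h1]
    ring
  · have h1 := weightedMean_congr (μ := μ) hΞ (h.iterate_radDeriv_succ hΞ n) hX
    rw [weightedMean_neg, weightedMean_eq hΞ hμ (hv n) hX] at h1
    rw [← norm_xPart_sq]
    simp only [meanField]
    rw [h1]
    ring

/-! ### The Dirac operator -/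

section Clifford

variable {σ : Type} [Fintype σ]

theorem ι_mul_ι_add_swap_negSq (x y : σ → ℝ) :
    CliffordAlgebra.ι (negSq σ) x * CliffordAlgebra.ι (negSq σ) y +
      CliffordAlgebra.ι (negSq σ) y * CliffordAlgebra.ι (negSq σ) x =
      algebraMap ℝ (Cl σ) (-(2 * ∑ j, x j * y j)) := by
  rw [CliffordAlgebra.ι_mul_ι_add_swap]
  congr 1
  simp only [QuadraticMap.polar, negSq, QuadraticMap.weightedSumSquares_apply, Pi.add_apply,
    smul_eq_mul]
  rw [← Finset.sum_sub_distrib, ← Finset.sum_sub_distrib, Finset.mul_sum, ← Finset.sum_neg_distrib]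
  refine Finset.sum_congr rfl fun j _ => ?_
  ring

/-- Multiplication as a continuous bilinear map. -/
def mulCLM (σ : Type) [Fintype σ] : Cl σ →L[ℝ] Cl σ →L[ℝ] Cl σ :=
  (LinearMap.mul ℝ (Cl σ)).toContinuousBilinearMap

theorem mulCLM_apply (x y : Cl σ) : mulCLM σ x y = x * y := rfl

section Calculus

variable {E : Type*} [NormedAddCommGroup E] [NormedSpace ℝ E] {f g : E → Cl σ} {X : E}
  {n : WithTop ℕ∞}

/-- The norm on `Cl σ` need not be submultiplicative; the product rules rest on multiplication being
a continuous bilinear map in finite dimension. -/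
theorem contDiff_mul (hf : ContDiff ℝ n f) (hg : ContDiff ℝ n g) :
    ContDiff ℝ n fun x => f x * g x :=
  ((mulCLM σ).contDiff.comp hf).clm_apply hg

theorem differentiableAt_mul (hf : DifferentiableAt ℝ f X) (hg : DifferentiableAt ℝ g X) :
    DifferentiableAt ℝ (fun x => f x * g x) X :=
  ((mulCLM σ).differentiableAt.comp X hf).clm_apply hg

theorem fderiv_mul_apply (hf : DifferentiableAt ℝ f X) (hg : DifferentiableAt ℝ g X) (v : E) :
    fderiv ℝ (fun x => f x * g x) X v = fderiv ℝ f X v * g X + f X * fderiv ℝ g X v := by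
  have h := (((mulCLM σ).hasFDerivAt.comp X hf.hasFDerivAt).clm_apply hg.hasFDerivAt).fderiv
  change fderiv ℝ (fun x => f x * g x) X = _ at h
  rw [h]
  simp [mulCLM_apply, add_comm]

end Calculus

variable [DecidableEq σ]

theorem gen_mul_gen_add_swap (i j : σ) :
    (gen i : Cl σ) * gen j + gen j * gen i = if i = j then -2 else 0 := by
  rw [gen, gen, ι_mul_ι_add_swap_negSq]
  by_cases h : i = j
  · subst h
    simpa [Pi.single_apply] using map_ofNat (algebraMap ℝ (Cl σ)) 2
  · simp [Pi.single_apply, h, Ne.symm h]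

/-- The Clifford vector `∑ⱼ χⱼ xⱼ eⱼ`. -/
def vec (χ : σ → ℝ) (X : EuclideanSpace ℝ σ) : Cl σ := ∑ j, (χ j * X j) • gen j

theorem vec_eq_ι (χ : σ → ℝ) (X : EuclideanSpace ℝ σ) :
    vec χ X = CliffordAlgebra.ι (negSq σ) fun j => χ j * X j := by
  simp only [vec, gen, ← map_smul, ← map_sum]
  congr 1
  ext i
  simp [Finset.sum_apply, Pi.single_apply]

theorem vec_mul_vec_swap (χ χ' : σ → ℝ) (X : EuclideanSpace ℝ σ) :
    vec χ X * vec χ' X = -(vec χ' X * vec χ X) - (2 * ∑ j, χ j * X j * (χ' j * X j)) • 1 := by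
  have h := ι_mul_ι_add_swap_negSq (fun j => χ j * X j) (fun j => χ' j * X j)
  rw [← vec_eq_ι, ← vec_eq_ι, Algebra.algebraMap_eq_smul_one, neg_smul] at h
  rw [eq_sub_of_add_eq h]
  abel

theorem gen_mul_vec (χ : σ → ℝ) (X : EuclideanSpace ℝ σ) (i : σ) :
    gen i * vec χ X = -(vec χ X * gen i) - (2 * (χ i * X i)) • 1 := by
  have h := ι_mul_ι_add_swap_negSq (Pi.single i 1) (fun j => χ j * X j)
  rw [← vec_eq_ι, Algebra.algebraMap_eq_smul_one, neg_smul] at h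
  simp only [Pi.single_apply, ite_mul, one_mul, zero_mul, Finset.sum_ite_eq', Finset.mem_univ,
    if_true] at h
  rw [gen, eq_sub_of_add_eq h]
  abel

theorem gen_mul_self (i : σ) : (gen i : Cl σ) * gen i = -1 := by
  have h := gen_mul_gen_add_swap i i
  rw [if_pos rfl, ← two_smul ℝ, show (-2 : Cl σ) = (2 : ℝ) • (-1 : Cl σ) by
    rw [smul_neg, two_smul]; norm_num] at h
  exact smul_right_injective (Cl σ) (two_ne_zero : (2 : ℝ) ≠ 0) h

/-- `X ↦ (χⱼ xⱼ)ⱼ`. -/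
def mask (χ : σ → ℝ) (X : EuclideanSpace ℝ σ) : EuclideanSpace ℝ σ :=
  WithLp.toLp 2 fun j => χ j * X j

theorem mask_eq_sum (χ : σ → ℝ) (X : EuclideanSpace ℝ σ) :
    mask χ X = ∑ j, (χ j * X j) • EuclideanSpace.single j (1 : ℝ) := by
  ext i
  simp [mask, Finset.sum_apply, Pi.single_apply]

/-- `vec χ` as a continuous linear map. -/
def vecCLM (χ : σ → ℝ) : EuclideanSpace ℝ σ →L[ℝ] Cl σ :=
  ∑ j, (χ j • EuclideanSpace.proj (𝕜 := ℝ) j).smulRight (gen j)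

theorem coe_vecCLM (χ : σ → ℝ) : ⇑(vecCLM χ) = vec χ := by
  ext X
  simp [vecCLM, vec]

theorem contDiff_vec (χ : σ → ℝ) {n : WithTop ℕ∞} : ContDiff ℝ n (vec χ) :=
  coe_vecCLM χ ▸ (vecCLM χ).contDiff

theorem differentiableAt_vec (χ : σ → ℝ) (X : EuclideanSpace ℝ σ) :
    DifferentiableAt ℝ (vec χ) X :=
  coe_vecCLM χ ▸ (vecCLM χ).differentiableAt

theorem fderiv_vec (χ : σ → ℝ) (X v : EuclideanSpace ℝ σ) : fderiv ℝ (vec χ) X v = vec χ v := by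
  rw [← coe_vecCLM, (vecCLM χ).fderiv]

theorem vec_single (χ : σ → ℝ) (j : σ) :
    vec χ (EuclideanSpace.single j 1) = χ j • gen j := by
  rw [vec, Finset.sum_eq_single j] <;> simp +contextual [eq_comm]

section Dirac

variable {g : EuclideanSpace ℝ σ → Cl σ} {X : EuclideanSpace ℝ σ}

theorem dirac_congr {f : EuclideanSpace ℝ σ → Cl σ} (h : f =ᶠ[nhds X] g) :
    dirac f X = dirac g X := by
  simp only [dirac, h.fderiv_eq]

theorem dirac_const_smul (c : ℝ) (hg : DifferentiableAt ℝ g X) :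
    dirac (fun Y => c • g Y) X = c • dirac g X := by
  simp only [dirac, fderiv_fun_const_smul hg, smul_apply, mul_smul_comm, Finset.smul_sum]

theorem dirac_sub {f : EuclideanSpace ℝ σ → Cl σ} (hf : DifferentiableAt ℝ f X)
    (hg : DifferentiableAt ℝ g X) :
    dirac (fun Y => f Y - g Y) X = dirac f X - dirac g X := by
  simp only [dirac, fderiv_fun_sub hf hg, sub_apply, mul_sub, Finset.sum_sub_distrib]

theorem dirac_smul {a : EuclideanSpace ℝ σ → ℝ} {χ χ' : σ → ℝ} {α β : ℝ}
    (ha : HasFDerivAt a (α • gradForm χ X + β • gradForm χ' X) X) (hg : DifferentiableAt ℝ g X) :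
    dirac (fun Y => a Y • g Y) X =
      α • (vec χ X * g X) + β • (vec χ' X * g X) + a X • dirac g X := by
  have h := (ha.smul hg.hasFDerivAt).fderiv
  change fderiv ℝ (fun Y => a Y • g Y) X = _ at h
  simp only [dirac, h, vec, Finset.sum_mul, Finset.smul_sum, ← Finset.sum_add_distrib]
  refine Finset.sum_congr rfl fun j _ => ?_
  simp only [add_apply, smul_apply, ContinuousLinearMap.smulRight_apply, gradForm_single,
    smul_eq_mul, mul_add, mul_smul_comm, smul_mul_assoc, smul_smul, add_smul]
  abel

/-- The squares e_j² = -1 produce the term with ∑ χ_j, and moving e_j past the vector produces the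
Euler operator. -/
theorem dirac_vec_mul (χ : σ → ℝ) (hg : DifferentiableAt ℝ g X) :
    dirac (fun Y => vec χ Y * g Y) X =
      -(vec χ X * dirac g X) - (∑ j, χ j) • g X - (2 : ℝ) • fderiv ℝ g X (mask χ X) := by
  simp only [dirac, fderiv_mul_apply (differentiableAt_vec χ X) hg, fderiv_vec, vec_single,
    mask_eq_sum, map_sum, map_smul, Finset.mul_sum, Finset.sum_smul, Finset.smul_sum,
    ← Finset.sum_neg_distrib, ← Finset.sum_sub_distrib]
  refine Finset.sum_congr rfl fun j _ => ?_
  rw [mul_add, smul_mul_assoc, mul_smul_comm, ← mul_assoc, gen_mul_self, ← mul_assoc, gen_mul_vec,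
    sub_mul, smul_mul_assoc, one_mul, neg_mul, neg_mul, one_mul, smul_smul, smul_neg, mul_assoc]
  abel

theorem dirac_dirac (hg : ContDiffAt ℝ 2 g X) :
    dirac (dirac g) X = -Laplacian.laplacian g X := by
  have hd : DifferentiableAt ℝ (fderiv ℝ g) X :=
    (hg.fderiv_right (m := 1) (by norm_num)).differentiableAt (by simp)
  have hs : IsSymmSndFDerivAt ℝ g X := hg.isSymmSndFDerivAt (by simp)
  set H : σ → σ → Cl σ := fun i j => fderiv ℝ (fderiv ℝ g) X (EuclideanSpace.single i 1)
    (EuclideanSpace.single j 1) with hH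
  have hsymm : ∀ i j, H i j = H j i := fun i j => hs _ _
  have h1 : dirac (dirac g) X = ∑ i, ∑ j, gen i * gen j * H i j := by
    have hj : ∀ j, DifferentiableAt ℝ
        (fun Y => gen j * fderiv ℝ g Y (EuclideanSpace.single j 1)) X := fun j =>
      differentiableAt_mul (differentiableAt_const _) (hd.clm_apply (differentiableAt_const _))
    rw [dirac]
    refine Finset.sum_congr rfl fun i _ => ?_
    have e : dirac g = fun Y => ∑ j, gen j * fderiv ℝ g Y (EuclideanSpace.single j 1) := rfl
    rw [e, fderiv_fun_sum fun j _ => hj j, sum_apply, Finset.mul_sum]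
    refine Finset.sum_congr rfl fun j _ => ?_
    rw [fderiv_mul_apply (differentiableAt_const _) (hd.clm_apply (differentiableAt_const _)),
      fderiv_clm_apply hd (differentiableAt_const _)]
    simp [hH, mul_assoc]
  have h2 : Laplacian.laplacian g X = ∑ i, H i i := by
    rw [InnerProductSpace.laplacian_eq_iteratedFDeriv_orthonormalBasis g
      (EuclideanSpace.basisFun σ ℝ)]
    simp [iteratedFDeriv_two_apply, hH]
  -- Doubling symmetrises the sum, since H is symmetric; the anticommutators then leave only the
  -- diagonal.
  have h3 : (2 : ℝ) • ∑ i, ∑ j, gen i * gen j * H i j = (2 : ℝ) • -∑ i, H i i := by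
    have h4 : (2 : ℝ) • ∑ i, ∑ j, gen i * gen j * H i j =
        ∑ i, ∑ j, ((gen i : Cl σ) * gen j + gen j * gen i) * H i j := by
      rw [two_smul]
      nth_rewrite 2 [Finset.sum_comm]
      rw [← Finset.sum_add_distrib]
      refine Finset.sum_congr rfl fun i _ => ?_
      rw [← Finset.sum_add_distrib]
      refine Finset.sum_congr rfl fun j _ => ?_
      rw [hsymm j i, add_mul]
    rw [h4]
    simp only [gen_mul_gen_add_swap, ite_mul, zero_mul, Finset.sum_ite_eq, Finset.mem_univ, if_true]
    rw [← Finset.sum_neg_distrib, Finset.smul_sum]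
    refine Finset.sum_congr rfl fun i _ => ?_
    rw [smul_neg, two_smul, neg_mul, two_mul]
  rw [h1, h2]
  exact smul_right_injective (Cl σ) (two_ne_zero : (2 : ℝ) ≠ 0) h3

end Dirac

end Clifford

/-! ### Iterated Laplacians of biaxial functions -/

section Biaxial

variable {p q : ℕ}

theorem vec_right_mask_left (X : EuclideanSpace ℝ (Fin p ⊕ Fin q)) :
    vec (rightInd p q) (mask (leftInd p q) X) = 0 := by
  simp [vec, mask, leftInd, rightInd]

theorem vec_left_mul_self (X : EuclideanSpace ℝ (Fin p ⊕ Fin q)) :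
    vec (leftInd p q) X * vec (leftInd p q) X = -(sqForm (leftInd p q) X • 1) := by
  rw [vec_eq_ι, CliffordAlgebra.ι_sq_scalar, Algebra.algebraMap_eq_smul_one, ← neg_smul]
  congr 1
  simp [negSq, QuadraticMap.weightedSumSquares_apply, sqForm, leftInd, sq]

theorem vec_right_mul_self (X : EuclideanSpace ℝ (Fin p ⊕ Fin q)) :
    vec (rightInd p q) X * vec (rightInd p q) X = -(sqForm (rightInd p q) X • 1) := by
  rw [vec_eq_ι, CliffordAlgebra.ι_sq_scalar, Algebra.algebraMap_eq_smul_one, ← neg_smul]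
  congr 1
  simp [negSq, QuadraticMap.weightedSumSquares_apply, sqForm, rightInd, sq]

theorem vec_right_mul_left (X : EuclideanSpace ℝ (Fin p ⊕ Fin q)) :
    vec (rightInd p q) X * vec (leftInd p q) X = -(vec (leftInd p q) X * vec (rightInd p q) X) := by
  rw [vec_mul_vec_swap]
  simp [leftInd, rightInd]

/-- Monogenic functions on `ℝ^p ⊕ ℝ^q` that are homogeneous of degree `k` in `x` and `l` in `y`. -/
structure IsBihomogeneousMonogenic (k l : ℕ)
    (G : EuclideanSpace ℝ (Fin p ⊕ Fin q) → Cl (Fin p ⊕ Fin q)) : Prop where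
  smooth : ContDiff ℝ ∞ G
  dirac_eq : ∀ X, dirac G X = 0
  euler_left : ∀ X, fderiv ℝ G X (mask (leftInd p q) X) = (k : ℝ) • G X
  euler_right : ∀ X, fderiv ℝ G X (mask (rightInd p q) X) = (l : ℝ) • G X

/-- The function `(a - b x y) G`. -/
def biaxialField (a b : EuclideanSpace ℝ (Fin p ⊕ Fin q) → ℝ)
    (G : EuclideanSpace ℝ (Fin p ⊕ Fin q) → Cl (Fin p ⊕ Fin q))
    (X : EuclideanSpace ℝ (Fin p ⊕ Fin q)) : Cl (Fin p ⊕ Fin q) :=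
  a X • G X - b X • (vec (leftInd p q) X * (vec (rightInd p q) X * G X))

variable {k l : ℕ} {G : EuclideanSpace ℝ (Fin p ⊕ Fin q) → Cl (Fin p ⊕ Fin q)}
  {Ω : Set (EuclideanSpace ℝ (Fin p ⊕ Fin q))}

theorem contDiffOn_biaxialField {a b : EuclideanSpace ℝ (Fin p ⊕ Fin q) → ℝ}
    (ha : ContDiffOn ℝ ∞ a Ω) (hb : ContDiffOn ℝ ∞ b Ω) (hG : ContDiff ℝ ∞ G) :
    ContDiffOn ℝ ∞ (biaxialField a b G) Ω :=
  (ha.smul hG.contDiffOn).sub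
    (hb.smul (contDiff_mul (contDiff_vec _) (contDiff_mul (contDiff_vec _) hG)).contDiffOn)

namespace IsBihomogeneousMonogenic

theorem differentiableAt (hG : IsBihomogeneousMonogenic k l G)
    (X : EuclideanSpace ℝ (Fin p ⊕ Fin q)) : DifferentiableAt ℝ G X :=
  hG.smooth.differentiable (by simp) X

theorem dirac_left_mul (hG : IsBihomogeneousMonogenic k l G)
    (X : EuclideanSpace ℝ (Fin p ⊕ Fin q)) :
    dirac (fun Y => vec (leftInd p q) Y * G Y) X = -((p + 2 * k : ℝ) • G X) := by
  rw [dirac_vec_mul _ (hG.differentiableAt X), hG.dirac_eq, hG.euler_left]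
  simp [leftInd]
  module

theorem dirac_right_mul (hG : IsBihomogeneousMonogenic k l G)
    (X : EuclideanSpace ℝ (Fin p ⊕ Fin q)) :
    dirac (fun Y => vec (rightInd p q) Y * G Y) X = -((q + 2 * l : ℝ) • G X) := by
  rw [dirac_vec_mul _ (hG.differentiableAt X), hG.dirac_eq, hG.euler_right]
  simp [rightInd]
  module

theorem dirac_left_mul_right_mul (hG : IsBihomogeneousMonogenic k l G)
    (X : EuclideanSpace ℝ (Fin p ⊕ Fin q)) :
    dirac (fun Y => vec (leftInd p q) Y * (vec (rightInd p q) Y * G Y)) X =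
      (q + 2 * l : ℝ) • (vec (leftInd p q) X * G X) -
        (p + 2 * k : ℝ) • (vec (rightInd p q) X * G X) := by
  have hr := differentiableAt_vec (rightInd p q) X
  rw [dirac_vec_mul _ (differentiableAt_mul hr (hG.differentiableAt X)), hG.dirac_right_mul,
    fderiv_mul_apply hr (hG.differentiableAt X), fderiv_vec, vec_right_mask_left, hG.euler_left,
    mul_neg, mul_smul_comm, mul_smul_comm, zero_mul]
  simp [leftInd]
  module

variable {a b a' b' : ℕ → EuclideanSpace ℝ (Fin p ⊕ Fin q) → ℝ}

/-- Only terms in x G and y G arise. Those in y G cancel by `vert`; in those with x G, `horiz`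
removes ρ² b_{n+1} and leaves the factor (2n+1) - (q+2ℓ). -/
theorem dirac_biaxialField (hG : IsBihomogeneousMonogenic k l G)
    (h : IsVekuaSequence Ω (p + 2 * k) a b a' b') (n : ℕ)
    {X : EuclideanSpace ℝ (Fin p ⊕ Fin q)} (hX : X ∈ Ω) :
    dirac (biaxialField (a n) (b n) G) X =
      (2 * n + 1 - q - 2 * l : ℝ) • (b n X • (vec (leftInd p q) X * G X)) := by
  have hGX := hG.differentiableAt X
  have hxy : DifferentiableAt ℝ (fun Y => vec (leftInd p q) Y * (vec (rightInd p q) Y * G Y)) X :=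
    differentiableAt_mul (differentiableAt_vec _ X)
      (differentiableAt_mul (differentiableAt_vec _ X) hGX)
  have ha := h.deriv_left n X hX
  have hb := h.deriv_right n X hX
  have e : biaxialField (a n) (b n) G = fun Y => a n Y • G Y -
    b n Y • (vec (leftInd p q) Y * (vec (rightInd p q) Y * G Y)) := rfl
  rw [e, dirac_sub (ha.differentiableAt.fun_smul hGX) (hb.differentiableAt.fun_smul hxy),
    dirac_smul ha hGX, dirac_smul hb hxy, hG.dirac_eq, hG.dirac_left_mul_right_mul]
  have e1 : vec (leftInd p q) X * (vec (leftInd p q) X * (vec (rightInd p q) X * G X)) =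
      -(sqForm (leftInd p q) X • (vec (rightInd p q) X * G X)) := by
    rw [← mul_assoc, vec_left_mul_self, neg_mul, smul_mul_assoc, one_mul]
  have e2 : vec (rightInd p q) X * (vec (leftInd p q) X * (vec (rightInd p q) X * G X)) =
      sqForm (rightInd p q) X • (vec (leftInd p q) X * G X) := by
    rw [← mul_assoc, vec_right_mul_left, ← mul_assoc, neg_mul, mul_assoc (vec (leftInd p q) X),
      vec_right_mul_self]
    simp
  rw [e1, e2, h.horiz n X hX, h.vert n X hX]
  module

/-- As x² = -r², the scalar part is -(r² b' + (p+2k) b), which is a_{n+1} by `vert`; y x = -x y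
gives the other part. -/
theorem dirac_smul_left_mul (hG : IsBihomogeneousMonogenic k l G)
    (h : IsVekuaSequence Ω (p + 2 * k) a b a' b') (n : ℕ)
    {X : EuclideanSpace ℝ (Fin p ⊕ Fin q)} (hX : X ∈ Ω) :
    dirac (fun Y => b n Y • (vec (leftInd p q) Y * G Y)) X =
      biaxialField (a (n + 1)) (b (n + 1)) G X := by
  have hx : DifferentiableAt ℝ (fun Y => vec (leftInd p q) Y * G Y) X :=
    differentiableAt_mul (differentiableAt_vec _ X) (hG.differentiableAt X)
  rw [dirac_smul (h.deriv_right n X hX) hx, hG.dirac_left_mul, biaxialField, h.vert n X hX,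
    ← mul_assoc, ← mul_assoc, ← mul_assoc, vec_right_mul_left, vec_left_mul_self, neg_mul, neg_mul,
    smul_mul_assoc, one_mul]
  module

theorem laplacian_biaxialField (hG : IsBihomogeneousMonogenic k l G) (hΩ : IsOpen Ω)
    (h : IsVekuaSequence Ω (p + 2 * k) a b a' b') (n : ℕ)
    {X : EuclideanSpace ℝ (Fin p ⊕ Fin q)} (hX : X ∈ Ω) :
    Laplacian.laplacian (biaxialField (a n) (b n) G) X =
      (q + 2 * l - (2 * n + 1) : ℝ) • biaxialField (a (n + 1)) (b (n + 1)) G X := by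
  have hF := (contDiffOn_biaxialField (h.smooth_left n) (h.smooth_right n) hG.smooth).contDiffAt
    (hΩ.mem_nhds hX)
  have hD : dirac (biaxialField (a n) (b n) G) =ᶠ[nhds X] fun Y =>
      (2 * n + 1 - q - 2 * l : ℝ) • (b n Y • (vec (leftInd p q) Y * G Y)) := by
    filter_upwards [hΩ.mem_nhds hX] with Y hY using hG.dirac_biaxialField h n hY
  have hx : DifferentiableAt ℝ (fun Y => vec (leftInd p q) Y * G Y) X :=
    differentiableAt_mul (differentiableAt_vec _ X) (hG.differentiableAt X)
  rw [← neg_neg (Laplacian.laplacian (biaxialField (a n) (b n) G) X),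
    ← dirac_dirac (hF.of_le (WithTop.coe_le_coe.2 le_top)), dirac_congr hD,
    dirac_const_smul _ ((h.deriv_right n X hX).differentiableAt.fun_smul hx),
    hG.dirac_smul_left_mul h n hX]
  module

theorem iterate_laplacian_biaxialField (hG : IsBihomogeneousMonogenic k l G) (hΩ : IsOpen Ω)
    (h : IsVekuaSequence Ω (p + 2 * k) a b a' b')
    {F : EuclideanSpace ℝ (Fin p ⊕ Fin q) → Cl (Fin p ⊕ Fin q)}
    (hF₀ : Set.EqOn F (biaxialField (a 0) (b 0) G) Ω) (n : ℕ) :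
    ∃ c : ℝ, Set.EqOn
      ((fun f : EuclideanSpace ℝ (Fin p ⊕ Fin q) → Cl (Fin p ⊕ Fin q) =>
        Laplacian.laplacian f)^[n] F)
      (fun X => c • biaxialField (a n) (b n) G X) Ω := by
  induction n with
  | zero => exact ⟨1, fun X hX => by simp [hF₀ hX]⟩
  | succ n ih =>
    obtain ⟨c, hc⟩ := ih
    refine ⟨c * (q + 2 * l - (2 * n + 1)), fun X hX => ?_⟩
    have hF := (contDiffOn_biaxialField (h.smooth_left n) (h.smooth_right n)
      hG.smooth).contDiffAt (hΩ.mem_nhds hX)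
    rw [Function.iterate_succ_apply', (InnerProductSpace.laplacian_congr_nhds
      (hc.eventuallyEq_of_mem (hΩ.mem_nhds hX))).eq_of_nhds]
    have h1 := InnerProductSpace.laplacian_smul c (hF.of_le (WithTop.coe_le_coe.2 le_top))
    change Laplacian.laplacian (fun X => c • biaxialField (a n) (b n) G X) X = _ at h1
    rw [h1, hG.laplacian_biaxialField hΩ h n hX, smul_smul]

theorem isMonogenicOn_iterate_laplacian (hG : IsBihomogeneousMonogenic k l G) (hΩ : IsOpen Ω)
    (h : IsVekuaSequence Ω (p + 2 * k) a b a' b')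
    {F : EuclideanSpace ℝ (Fin p ⊕ Fin q) → Cl (Fin p ⊕ Fin q)}
    (hF₀ : Set.EqOn F (biaxialField (a 0) (b 0) G) Ω) {N : ℕ} (hN : 2 * N + 1 = q + 2 * l) :
    IsMonogenicOn
      ((fun f : EuclideanSpace ℝ (Fin p ⊕ Fin q) → Cl (Fin p ⊕ Fin q) =>
        Laplacian.laplacian f)^[N] F) Ω := by
  obtain ⟨c, hc⟩ := hG.iterate_laplacian_biaxialField hΩ h hF₀ N
  have hF := (contDiffOn_biaxialField (h.smooth_left N) (h.smooth_right N) hG.smooth)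
  refine ⟨((hF.const_smul c).congr hc).of_le (WithTop.coe_le_coe.2 le_top), fun X hX => ?_⟩
  rw [dirac_congr (hc.eventuallyEq_of_mem (hΩ.mem_nhds hX)), dirac_const_smul _
    ((hF.contDiffAt (hΩ.mem_nhds hX)).differentiableAt (by simp)),
    hG.dirac_biaxialField h N hX]
  have : (2 * N + 1 - q - 2 * l : ℝ) = 0 := by
    have : (2 * N + 1 : ℝ) = q + 2 * l := mod_cast hN
    linarith
  rw [this, zero_smul, smul_zero]

end IsBihomogeneousMonogenic

end Biaxial

/-! ### Products of homogeneous monogenic polynomials -/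

section Polynomial

variable {σ : Type} [Fintype σ] [DecidableEq σ] {k : ℕ} {P : EuclideanSpace ℝ σ → Cl σ}

theorem IsHomogeneousPolynomial.contDiff (hP : IsHomogeneousPolynomial k P) : ContDiff ℝ ∞ P := by
  obtain ⟨c, hc⟩ := hP
  rw [funext hc]
  fun_prop

theorem IsHomogeneousPolynomial.map_smul (hP : IsHomogeneousPolynomial k P) (t : ℝ)
    (x : EuclideanSpace ℝ σ) : P (t • x) = t ^ k • P x := by
  obtain ⟨c, hc⟩ := hP
  rw [hc, hc, Finset.smul_sum]
  refine Finset.sum_congr rfl fun α hα => ?_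
  rw [smul_smul, ← (Finset.mem_piAntidiag.1 hα).1, ← Finset.prod_pow_eq_pow_sum,
    ← Finset.prod_mul_distrib]
  simp [mul_pow]

/-- Euler's identity. -/
theorem IsHomogeneousPolynomial.fderiv_self (hP : IsHomogeneousPolynomial k P)
    (x : EuclideanSpace ℝ σ) : fderiv ℝ P x x = (k : ℝ) • P x := by
  have hd : DifferentiableAt ℝ P ((1 : ℝ) • x) := hP.contDiff.differentiable (by simp) _
  have h1 : HasDerivAt (fun t : ℝ => t • x) x 1 := by
    simpa using (hasDerivAt_id (1 : ℝ)).smul_const x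
  have h2 := hd.hasFDerivAt.comp_hasDerivAt (1 : ℝ) h1
  have h3 := (hasDerivAt_pow k (1 : ℝ)).smul_const (P x)
  have e : P ∘ (fun t : ℝ => t • x) = fun t => t ^ k • P x := funext fun t => hP.map_smul t x
  rw [e, one_smul] at h2
  simpa using h2.unique h3

end Polynomial

/-! ### Inclusions of the two Clifford algebras. -/

section Inclusion

variable {σ τ : Type} [Fintype σ] [Fintype τ]

/-- `incl f` as a continuous linear map. -/
def inclCLM (f : σ ↪ τ) : Cl σ →L[ℝ] Cl τ := LinearMap.toContinuousLinearMap (incl f).toLinearMap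

theorem incl_gen [DecidableEq σ] [DecidableEq τ] (f : σ ↪ τ) (j : σ) :
    incl f (gen j) = gen (f j) := by
  rw [incl, gen, gen, CliffordAlgebra.map_apply_ι]
  congr 1
  change Function.extend f (Pi.single j 1) 0 = _
  ext i
  by_cases h : ∃ a, f a = i
  · obtain ⟨a, rfl⟩ := h
    rw [f.injective.extend_apply]
    simp [Pi.single_apply]
  · rw [Function.extend_apply' _ _ _ h, Pi.single_apply, if_neg fun h' => h ⟨j, h'.symm⟩]
    rfl

/-- Generators of orthogonal summands anticommute, so passing an even element costs an even number
of signs. -/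
theorem commute_incl_gen {p q : ℕ} {a : Cl (Fin p)}
    (ha : a ∈ CliffordAlgebra.even (negSq (Fin p))) (j : Fin q) :
    Commute (incl Function.Embedding.inl a) (gen (Sum.inr j : Fin p ⊕ Fin q)) := by
  have h := CliffordAlgebra.commute_map_mul_map_of_isOrtho_of_mem_evenOdd_zero_left
    (inclIsometry (Function.Embedding.inl : Fin p ↪ Fin p ⊕ Fin q))
    (inclIsometry (Function.Embedding.inr : Fin q ↪ Fin p ⊕ Fin q))
    (by
      intro x y
      change negSq _ (Function.extend Sum.inl x 0 + Function.extend Sum.inr y 0) =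
        negSq _ (Function.extend Sum.inl x 0) + negSq _ (Function.extend Sum.inr y 0)
      simp [negSq, QuadraticMap.weightedSumSquares_apply, add_comm])
    a (gen j) ha (CliffordAlgebra.ι_mem_evenOdd_one _ _)
  have h' : Commute (incl Function.Embedding.inl a) (incl Function.Embedding.inr (gen j)) := h
  rwa [incl_gen] at h'

end Inclusion

/-! ### The product P_k(x) P_ℓ(y). -/

section Product

variable {p q k l : ℕ} {Pk : EuclideanSpace ℝ (Fin p) → Cl (Fin p)}
  {Pl : EuclideanSpace ℝ (Fin q) → Cl (Fin q)}

theorem xPart_mask_left (X : EuclideanSpace ℝ (Fin p ⊕ Fin q)) :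
    xPart (mask (leftInd p q) X) = xPart X := by
  ext j
  simp [xPart, mask, leftInd]

theorem xPart_mask_right (X : EuclideanSpace ℝ (Fin p ⊕ Fin q)) :
    xPart (mask (rightInd p q) X) = 0 := by
  ext j
  simp [xPart, mask, rightInd]

theorem yPart_mask_left (X : EuclideanSpace ℝ (Fin p ⊕ Fin q)) :
    yPart (mask (leftInd p q) X) = 0 := by
  ext j
  simp [yPart, mask, leftInd]

theorem yPart_mask_right (X : EuclideanSpace ℝ (Fin p ⊕ Fin q)) :
    yPart (mask (rightInd p q) X) = yPart X := by
  ext j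
  simp [yPart, mask, rightInd]

theorem xPart_single_inl (j : Fin p) :
    xPart (EuclideanSpace.single (Sum.inl j : Fin p ⊕ Fin q) (1 : ℝ)) =
      EuclideanSpace.single j 1 := by
  ext i
  simp [xPart]

theorem xPart_single_inr (j : Fin q) :
    xPart (EuclideanSpace.single (Sum.inr j : Fin p ⊕ Fin q) (1 : ℝ)) = 0 := by
  ext i
  simp [xPart]

theorem yPart_single_inl (j : Fin p) :
    yPart (EuclideanSpace.single (Sum.inl j : Fin p ⊕ Fin q) (1 : ℝ)) = 0 := by
  ext i
  simp [yPart]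

theorem yPart_single_inr (j : Fin q) :
    yPart (EuclideanSpace.single (Sum.inr j : Fin p ⊕ Fin q) (1 : ℝ)) =
      EuclideanSpace.single j 1 := by
  ext i
  simp [yPart]

/-- The product `P_k(x) P_l(y)` in the Clifford algebra of `ℝ^p ⊕ ℝ^q`. -/
def polyProduct (Pk : EuclideanSpace ℝ (Fin p) → Cl (Fin p))
    (Pl : EuclideanSpace ℝ (Fin q) → Cl (Fin q)) (X : EuclideanSpace ℝ (Fin p ⊕ Fin q)) :
    Cl (Fin p ⊕ Fin q) :=
  incl Function.Embedding.inl (Pk (xPart X)) * incl Function.Embedding.inr (Pl (yPart X))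

theorem fderiv_polyProduct (hk : ContDiff ℝ ∞ Pk) (hl : ContDiff ℝ ∞ Pl)
    (X v : EuclideanSpace ℝ (Fin p ⊕ Fin q)) :
    fderiv ℝ (polyProduct Pk Pl) X v =
      incl Function.Embedding.inl (fderiv ℝ Pk (xPart X) (xPart v)) *
          incl Function.Embedding.inr (Pl (yPart X)) +
        incl Function.Embedding.inl (Pk (xPart X)) *
          incl Function.Embedding.inr (fderiv ℝ Pl (yPart X) (yPart v)) := by
  have h1 : HasFDerivAt (fun X : EuclideanSpace ℝ (Fin p ⊕ Fin q) =>
      (incl Function.Embedding.inl (Pk (xPart X)) : Cl (Fin p ⊕ Fin q))) _ X :=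
    (inclCLM Function.Embedding.inl).hasFDerivAt.comp X
      ((hk.differentiable (by simp) (xPart X)).hasFDerivAt.comp X (xPartCLM p q).hasFDerivAt)
  have h2 : HasFDerivAt (fun X : EuclideanSpace ℝ (Fin p ⊕ Fin q) =>
      (incl Function.Embedding.inr (Pl (yPart X)) : Cl (Fin p ⊕ Fin q))) _ X :=
    (inclCLM Function.Embedding.inr).hasFDerivAt.comp X
      ((hl.differentiable (by simp) (yPart X)).hasFDerivAt.comp X (yPartCLM p q).hasFDerivAt)
  have h3 := fderiv_mul_apply h1.differentiableAt h2.differentiableAt v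
  rw [h1.fderiv, h2.fderiv] at h3
  exact h3

/-- The x-part of the Dirac operator acts directly on the left factor; the y-part reaches P_ℓ after
its generators commute past the even P_k(x). The degrees come from Euler's identity. -/
theorem isBihomogeneousMonogenic_polyProduct (hk : IsHomogeneousPolynomial k Pk)
    (hk' : ∀ x, dirac Pk x = 0)
    (hke : ∀ x, Pk x ∈ CliffordAlgebra.even (negSq (Fin p)))
    (hl : IsHomogeneousPolynomial l Pl) (hl' : ∀ y, dirac Pl y = 0) :
    IsBihomogeneousMonogenic k l (polyProduct Pk Pl) := by
  refine ⟨?_, fun X => ?_, fun X => ?_, fun X => ?_⟩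
  · exact contDiff_mul
      ((inclCLM Function.Embedding.inl).contDiff.comp (hk.contDiff.comp (xPartCLM p q).contDiff))
      ((inclCLM Function.Embedding.inr).contDiff.comp (hl.contDiff.comp (yPartCLM p q).contDiff))
  · rw [dirac, Fintype.sum_sum_type]
    simp only [fderiv_polyProduct hk.contDiff hl.contDiff, xPart_single_inl, xPart_single_inr,
      yPart_single_inl, yPart_single_inr, map_zero, mul_zero, zero_mul, add_zero, zero_add]
    have e1 : ∀ j : Fin p, gen (Sum.inl j : Fin p ⊕ Fin q) *
        (incl Function.Embedding.inl (fderiv ℝ Pk (xPart X) (EuclideanSpace.single j 1)) *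
          incl Function.Embedding.inr (Pl (yPart X))) =
        incl Function.Embedding.inl (gen j * fderiv ℝ Pk (xPart X) (EuclideanSpace.single j 1)) *
          incl Function.Embedding.inr (Pl (yPart X)) := fun j => by
      rw [map_mul, incl_gen, mul_assoc]
      rfl
    have e2 : ∀ j : Fin q, gen (Sum.inr j : Fin p ⊕ Fin q) *
        (incl Function.Embedding.inl (Pk (xPart X)) *
          incl Function.Embedding.inr (fderiv ℝ Pl (yPart X) (EuclideanSpace.single j 1))) =
        incl Function.Embedding.inl (Pk (xPart X)) * incl Function.Embedding.inr
          (gen j * fderiv ℝ Pl (yPart X) (EuclideanSpace.single j 1)) := fun j => by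
      rw [← mul_assoc, ← (commute_incl_gen (hke _) j).eq, map_mul, incl_gen, mul_assoc]
      rfl
    simp only [e1, e2]
    rw [← Finset.sum_mul, ← Finset.mul_sum, ← map_sum, ← map_sum]
    have h1 := hk' (xPart X)
    have h2 := hl' (yPart X)
    rw [dirac] at h1 h2
    rw [h1, h2]
    simp
  · rw [fderiv_polyProduct hk.contDiff hl.contDiff, xPart_mask_left, yPart_mask_left,
      hk.fderiv_self]
    simp [polyProduct]
  · rw [fderiv_polyProduct hk.contDiff hl.contDiff, xPart_mask_right, yPart_mask_right,
      hl.fderiv_self]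
    simp [polyProduct]

end Product

/-! ### The Fueter–Funk–Hecke transform -/

section Holomorphic

variable {Ξ : Set ℂ} {h : ℂ → ℂ}

theorem differentiableOn_iteratedDeriv (hΞ : IsOpen Ξ) (hh : DifferentiableOn ℂ h Ξ) (n : ℕ) :
    DifferentiableOn ℂ (iteratedDeriv n h) Ξ := by
  induction n with
  | zero => simpa using hh
  | succ n ih =>
    rw [iteratedDeriv_succ]
    exact ih.deriv hΞ

theorem contDiffOn_re (hΞ : IsOpen Ξ) (hh : DifferentiableOn ℂ h Ξ) :
    ContDiffOn ℝ ∞ (fun z => (h z).re) Ξ :=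
  Complex.reCLM.contDiff.comp_contDiffOn ((hh.contDiffOn hΞ).restrict_scalars ℝ)

theorem contDiffOn_im_comp (hΞ : IsOpen Ξ) (hh : DifferentiableOn ℂ h Ξ) :
    ContDiffOn ℝ ∞ (fun z => (h z).im) Ξ :=
  Complex.imCLM.contDiff.comp_contDiffOn ((hh.contDiffOn hΞ).restrict_scalars ℝ)

theorem fderiv_re_apply {z : ℂ} (hh : DifferentiableAt ℂ h z) (v : ℂ) :
    fderiv ℝ (fun z => (h z).re) z v = (deriv h z * v).re := by
  have h1 : HasFDerivAt (fun z => (h z).re) _ z := Complex.reCLM.hasFDerivAt.comp z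
    (hh.hasDerivAt.hasFDerivAt.restrictScalars ℝ)
  rw [h1.fderiv]
  simp [mul_comm]

theorem fderiv_im_apply {z : ℂ} (hh : DifferentiableAt ℂ h z) (v : ℂ) :
    fderiv ℝ (fun z => (h z).im) z v = (deriv h z * v).im := by
  have h1 : HasFDerivAt (fun z => (h z).im) _ z := Complex.imCLM.hasFDerivAt.comp z
    (hh.hasDerivAt.hasFDerivAt.restrictScalars ℝ)
  rw [h1.fderiv]
  simp [mul_comm]

theorem isConjugatePair_re_im (hΞ : IsOpen Ξ) (hh : DifferentiableOn ℂ h Ξ) :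
    IsConjugatePair Ξ (fun z => (h z).re) fun z => (h z).im := by
  refine ⟨contDiffOn_re hΞ hh, contDiffOn_im_comp hΞ hh, fun z hz => ?_, fun z hz => ?_⟩ <;>
  · rw [fderiv_re_apply (hh.differentiableAt (hΞ.mem_nhds hz)),
      fderiv_im_apply (hh.differentiableAt (hΞ.mem_nhds hz))]
    simp

theorem horizDeriv_re_iteratedDeriv (hΞ : IsOpen Ξ) (hh : DifferentiableOn ℂ h Ξ) (n : ℕ) :
    Set.EqOn (horizDeriv fun z => (iteratedDeriv n h z).re)
      (fun z => (iteratedDeriv (n + 1) h z).re) Ξ := fun z hz => by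
  rw [horizDeriv, fderiv_re_apply
    ((differentiableOn_iteratedDeriv hΞ hh n).differentiableAt (hΞ.mem_nhds hz)), mul_one,
    iteratedDeriv_succ]

theorem horizDeriv_im_iteratedDeriv (hΞ : IsOpen Ξ) (hh : DifferentiableOn ℂ h Ξ) (n : ℕ) :
    Set.EqOn (horizDeriv fun z => (iteratedDeriv n h z).im)
      (fun z => (iteratedDeriv (n + 1) h z).im) Ξ := fun z hz => by
  rw [horizDeriv, fderiv_im_apply
    ((differentiableOn_iteratedDeriv hΞ hh n).differentiableAt (hΞ.mem_nhds hz)), mul_one,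
    iteratedDeriv_succ]

end Holomorphic

/-- The Rodrigues formula for the means with respect to Gegenbauer polynomials. -/
theorem funkHeckeMean_eq {Ξ : Set ℂ} (hΞ : IsDilationDomain Ξ) {p : ℕ} (hp : 3 ≤ p) (n : ℕ)
    {w : ℕ → ℂ → ℝ} (hw : ∀ m, ContDiffOn ℝ ∞ (w m) Ξ)
    (hw' : ∀ m, Set.EqOn (horizDeriv (w m)) (w (m + 1)) Ξ) {z : ℂ} (hz : z ∈ Ξ) :
    funkHeckeMean p n (w 0) z.re z.im = rodriguesConst (((p : ℝ) - 2) / 2) n * (z.re ^ n *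
      weightedMean (n + ((p : ℝ) - 3) / 2) (w n) z.re z.im) := by
  have hp' : (3 : ℝ) ≤ p := mod_cast hp
  -- Each t-derivative of w(rt, ρ) brings out a factor r; the resulting rⁿ compensates r^{-k} in A
  -- and B.
  have hchain : IsDerivChain fun m t => z.re ^ m * w m ⟨z.re * t, z.im⟩ := by
    intro m t ht
    refine ((hasDerivAt_comp_dilate hΞ (hw m) hz ht).const_mul (z.re ^ m)).congr_deriv ?_
    rw [hw' m (hΞ.dilate z hz t ht)]
    ring
  have h1 := integral_mul_gegenbauer (μ := ((p : ℝ) - 2) / 2) (by linarith) n hchain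
  have e : ((p : ℝ) - 2) / 2 - 1 / 2 = ((p : ℝ) - 3) / 2 := by ring
  have hpos := gegenbauer_eval_one_pos (μ := ((p : ℝ) - 2) / 2) (by linarith) n
  simp only [pow_zero, one_mul, e] at h1
  rw [funkHeckeMean, gegenbauerC, h1, weightedMean, ← intervalIntegral.integral_const_mul (z.re ^ n)]
  simp only [mul_assoc]
  rw [inv_mul_cancel_left₀ hpos.ne']

theorem weightedMean_const_mul (μ c : ℝ) (w : ℂ → ℝ) (r ρ : ℝ) :
    weightedMean μ (fun z => c * w z) r ρ = c * weightedMean μ w r ρ := by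
  rw [weightedMean, weightedMean, ← intervalIntegral.integral_const_mul]
  simp only [mul_assoc]

theorem weightedMean_slope (μ : ℝ) (v : ℂ → ℝ) (r ρ : ℝ) :
    weightedMean μ (slope v) r ρ = ρ⁻¹ * weightedMean μ (horizDeriv v) r ρ := by
  rw [weightedMean, weightedMean, ← intervalIntegral.integral_const_mul]
  simp only [slope, mul_assoc]

/-! ### The seed function in terms of weighted means. -/

section Seed

variable {p q : ℕ} (k : ℕ) {Ξ : Set ℂ} {h : ℂ → ℂ}

/-- The holomorphic function whose weighted means are `A` and `B`, up to constants. -/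
def normalizedDeriv (p k : ℕ) (h : ℂ → ℂ) (z : ℂ) : ℂ :=
  (rodriguesConst (((p : ℝ) - 2) / 2) k : ℂ) * iteratedDeriv k h z

theorem differentiableOn_normalizedDeriv (p : ℕ) (hΞ : IsOpen Ξ) (hh : DifferentiableOn ℂ h Ξ) :
    DifferentiableOn ℂ (normalizedDeriv p k h) Ξ :=
  (differentiableOn_iteratedDeriv hΞ hh k).const_mul _

theorem coeffA_eq (hΞ : IsDilationDomain Ξ) (hp : 3 ≤ p) (hh : DifferentiableOn ℂ h Ξ) {z : ℂ}
    (hz : z ∈ Ξ) (hk : z.re ≠ 0 ∨ k = 0) :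
    coeffA p k h z.re z.im =
      weightedMean (k + ((p : ℝ) - 3) / 2) (fun z => (normalizedDeriv p k h z).re) z.re z.im := by
  have h1 := funkHeckeMean_eq hΞ hp k (w := fun m z => (iteratedDeriv m h z).re)
    (fun m => contDiffOn_re hΞ.isOpen (differentiableOn_iteratedDeriv hΞ.isOpen hh m))
    (horizDeriv_re_iteratedDeriv hΞ.isOpen hh) hz
  simp only [iteratedDeriv_zero] at h1
  have h2 : z.re ^ (-(k : ℤ)) * z.re ^ k = 1 := by
    rcases hk with hr | rfl
    · rw [zpow_neg, zpow_natCast, inv_mul_cancel₀ (pow_ne_zero _ hr)]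
    · simp
  simp only [normalizedDeriv, Complex.re_ofReal_mul]
  rw [coeffA, h1, weightedMean_const_mul, mul_left_comm (z.re ^ (-(k : ℤ))),
    ← mul_assoc (z.re ^ (-(k : ℤ))), h2, one_mul]

/-- Degree k+1 against r^{-k} leaves one factor r, and ρ undoes the ρ⁻¹ in `slope`. The constant is
the ratio of consecutive Rodrigues constants, 1/(2k+p-1). -/
theorem coeffB_eq (hΞ : IsDilationDomain Ξ) (hp : 3 ≤ p) (hh : DifferentiableOn ℂ h Ξ) {z : ℂ}
    (hz : z ∈ Ξ) (hr : z.re ≠ 0) :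
    coeffB p k h z.re z.im = z.re * (z.im * ((2 * (k + ((p : ℝ) - 3) / 2 + 1))⁻¹ *
      weightedMean (k + ((p : ℝ) - 3) / 2 + 1) (slope fun z => (normalizedDeriv p k h z).im)
        z.re z.im)) := by
  have h1 := funkHeckeMean_eq hΞ hp (k + 1) (w := fun m z => (iteratedDeriv m h z).im)
    (fun m => contDiffOn_im_comp hΞ.isOpen (differentiableOn_iteratedDeriv hΞ.isOpen hh m))
    (horizDeriv_im_iteratedDeriv hΞ.isOpen hh) hz
  simp only [iteratedDeriv_zero] at h1
  have h2 : z.re ^ (-(k : ℤ)) * z.re ^ (k + 1) = z.re := by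
    rw [zpow_neg, zpow_natCast, pow_succ, inv_mul_cancel_left₀ (pow_ne_zero _ hr)]
  have h3 : Set.EqOn (horizDeriv fun z => (normalizedDeriv p k h z).im)
      (fun z => rodriguesConst (((p : ℝ) - 2) / 2) k * (iteratedDeriv (k + 1) h z).im) Ξ := by
    intro y hy
    have e : (fun z => (normalizedDeriv p k h z).im) =
        fun z => rodriguesConst (((p : ℝ) - 2) / 2) k * (iteratedDeriv k h z).im := by
      ext z
      rw [normalizedDeriv, Complex.im_ofReal_mul]
    have hd := differentiableAt_of_mem hΞ (contDiffOn_im_comp hΞ.isOpen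
      (differentiableOn_iteratedDeriv hΞ.isOpen hh k)) hy
    have h4 := horizDeriv_im_iteratedDeriv hΞ.isOpen hh k hy
    simp only [horizDeriv] at h4 ⊢
    rw [e, fderiv_const_mul hd, smul_apply, h4, smul_eq_mul]
  rw [coeffB, h1, weightedMean_slope, weightedMean_congr hΞ h3 hz, weightedMean_const_mul,
    rodriguesConst_succ, mul_left_comm (z.re ^ (-(k : ℤ))), ← mul_assoc (z.re ^ (-(k : ℤ))), h2]
  have e1 : ((k + 1 : ℕ) : ℝ) + ((p : ℝ) - 3) / 2 = k + ((p : ℝ) - 3) / 2 + 1 := by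
    push_cast
    ring
  have e2 : 2 * (k : ℝ) + 2 * (((p : ℝ) - 2) / 2) + 1 = 2 * (k + ((p : ℝ) - 3) / 2 + 1) := by ring
  have him := (hΞ.im_pos z hz).ne'
  rw [e1, e2]
  field_simp

theorem biaxialSeed_eq (hΞ : IsDilationDomain Ξ) (hp : 3 ≤ p) (hh : DifferentiableOn ℂ h Ξ)
    {Pk : EuclideanSpace ℝ (Fin p) → Cl (Fin p)} (hPk : IsHomogeneousPolynomial k Pk)
    (Pl : EuclideanSpace ℝ (Fin q) → Cl (Fin q)) :
    Set.EqOn (biaxialSeed k h Pk Pl)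
      (biaxialField (meanField (k + ((p : ℝ) - 3) / 2) fun z => (normalizedDeriv p k h z).re)
        (fun X => (2 * (k + ((p : ℝ) - 3) / 2 + 1))⁻¹ * meanField (k + ((p : ℝ) - 3) / 2 + 1)
          (slope fun z => (normalizedDeriv p k h z).im) X) (polyProduct Pk Pl))
      (biaxialRegion p q Ξ) := by
  intro X hX
  have hρ : ‖yPart X‖ ≠ 0 := (hΞ.im_pos _ hX).ne'
  have hx : ∑ j : Fin p, X (Sum.inl j) • (gen (Sum.inl j) : Cl (Fin p ⊕ Fin q)) =
      vec (leftInd p q) X := by simp [vec, leftInd]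
  have hy : ∑ j : Fin q, X (Sum.inr j) • (gen (Sum.inr j) : Cl (Fin p ⊕ Fin q)) =
      vec (rightInd p q) X := by simp [vec, rightInd]
  rw [biaxialSeed, mul_assoc, omega, nu, hx, hy, biaxialField]
  change _ * polyProduct Pk Pl X = _
  rw [sub_mul, Algebra.algebraMap_eq_smul_one, smul_mul_assoc, one_mul]
  -- At x = 0 both x y-terms vanish and only the coefficient of G matters. It agrees for k = 0, and
  -- for k ≥ 1 Euler's identity at the origin gives P_k(0) = 0.
  by_cases hr : ‖xPart X‖ = 0
  · have hx0 : vec (leftInd p q) X = 0 := by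
      rw [norm_eq_zero] at hr
      have : ∀ j, X (Sum.inl j) = 0 := fun j => congrArg (fun v => v.ofLp j) hr
      simp [← hx, this]
    rw [hx0, smul_zero, zero_mul, smul_zero, zero_mul, zero_mul, smul_zero]
    congr 1
    by_cases hk : k = 0
    · rw [coeffA_eq k hΞ hp hh hX (Or.inr hk), meanField]
    · have h0 : Pk (xPart X) = 0 := by
        have h1 := hPk.fderiv_self (xPart X)
        rw [norm_eq_zero.1 hr, map_zero] at h1
        rw [norm_eq_zero.1 hr]
        exact (smul_eq_zero.1 h1.symm).resolve_left (mod_cast hk)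
      simp [polyProduct, h0]
  · rw [coeffA_eq k hΞ hp hh hX (Or.inl hr), coeffB_eq k hΞ hp hh hX hr]
    change _ = weightedMean _ _ ‖xPart X‖ ‖yPart X‖ • _ -
      (_ * weightedMean _ _ ‖xPart X‖ ‖yPart X‖) • _
    simp only [smul_mul_assoc, mul_smul_comm, smul_smul, mul_assoc]
    -- The factor rρ in B cancels the two normalisations in ω ν.
    congr 2
    field_simp

end Seed

/-- The Fueter–Funk–Hecke theorem; evenness of `P_l` is not needed. -/
theorem fueterFunkHecke_main (p q k l : ℕ) (hp : 3 ≤ p) (hq : Odd q)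
    (Ξ : Set ℂ) (hΞ : IsDilationDomain Ξ) (h : ℂ → ℂ) (hh : DifferentiableOn ℂ h Ξ)
    (Pk : EuclideanSpace ℝ (Fin p) → Cl (Fin p)) (hPk : IsHomogeneousPolynomial k Pk)
    (hPk_mon : ∀ x, dirac Pk x = 0) (hPk_even : ∀ x, Pk x ∈ CliffordAlgebra.even (negSq (Fin p)))
    (Pl : EuclideanSpace ℝ (Fin q) → Cl (Fin q)) (hPl : IsHomogeneousPolynomial l Pl)
    (hPl_mon : ∀ y, dirac Pl y = 0) :
    ContDiffOn ℝ ∞ (biaxialSeed k h Pk Pl) (biaxialRegion p q Ξ) ∧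
      IsMonogenicOn (fueterFunkHecke k l h Pk Pl) (biaxialRegion p q Ξ) := by
  have hΩ : IsOpen (biaxialRegion p q Ξ) := isOpen_biaxialRegion hΞ.isOpen
  have hμ : (0 : ℝ) ≤ k + ((p : ℝ) - 3) / 2 := by
    have hp' : (3 : ℝ) ≤ p := mod_cast hp
    have : (0 : ℝ) ≤ ((p : ℝ) - 3) / 2 := by linarith
    positivity
  have hG := isBihomogeneousMonogenic_polyProduct hPk hPk_mon hPk_even hPl hPl_mon
  have hV := (isConjugatePair_re_im hΞ.isOpen
    (differentiableOn_normalizedDeriv k p hΞ.isOpen hh)).isVekuaSequence (p := p) (q := q) hΞ hμ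
  -- The exponent of the weight is such that κ matches the constant p + 2k produced by the Dirac
  -- operator on x G.
  rw [show 2 * ((k : ℝ) + ((p : ℝ) - 3) / 2) + 3 = p + 2 * k by ring] at hV
  have hS := biaxialSeed_eq k hΞ hp hh hPk Pl
  refine ⟨(contDiffOn_biaxialField (hV.smooth_left 0) (hV.smooth_right 0) hG.smooth).congr hS,
    hG.isMonogenicOn_iterate_laplacian hΩ hV hS ?_⟩
  -- Oddness makes the natural-number division (q-1)/2 exact.
  obtain ⟨m, rfl⟩ := hq
  omega

end CliffordAnalysis

end

theorem theorem3p2 (p q k l : ℕ) (hp : 3 ≤ p) (hq : Odd q)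
    (Ξ : Set ℂ) (hΞ_open : IsOpen Ξ) (hΞ_upper : ∀ z ∈ Ξ, 0 < z.im)
    (hΞ_dil : ∀ z ∈ Ξ, ∀ t ∈ Set.Icc (-1 : ℝ) 1, (⟨z.re * t, z.im⟩ : ℂ) ∈ Ξ)
    (h : ℂ → ℂ) (hh : DifferentiableOn ℂ h Ξ)
    (Pk : EuclideanSpace ℝ (Fin p) → CliffordAnalysis.Cl (Fin p))
    (hPk_hom : CliffordAnalysis.IsHomogeneousPolynomial k Pk)
    (hPk_mon : CliffordAnalysis.IsMonogenicOn Pk Set.univ)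
    (hPk_even : ∀ x, Pk x ∈ CliffordAlgebra.even (CliffordAnalysis.negSq (Fin p)))
    (Pl : EuclideanSpace ℝ (Fin q) → CliffordAnalysis.Cl (Fin q))
    (hPl_hom : CliffordAnalysis.IsHomogeneousPolynomial l Pl)
    (hPl_mon : CliffordAnalysis.IsMonogenicOn Pl Set.univ)
    (hPl_even : ∀ y, Pl y ∈ CliffordAlgebra.even (CliffordAnalysis.negSq (Fin q))) :
    ContDiffOn ℝ ∞ (CliffordAnalysis.biaxialSeed k h Pk Pl)
        (CliffordAnalysis.biaxialRegion p q Ξ) ∧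
      CliffordAnalysis.IsMonogenicOn (CliffordAnalysis.fueterFunkHecke k l h Pk Pl)
        (CliffordAnalysis.biaxialRegion p q Ξ) := by
  exact CliffordAnalysis.fueterFunkHecke_main p q k l hp hq Ξ ⟨hΞ_open, hΞ_upper, hΞ_dil⟩ h hh Pk
    hPk_hom (fun x => hPk_mon.2 x trivial) hPk_even Pl hPl_hom fun y => hPl_mon.2 y trivial
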